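/- Let $P\subset\mathbb{R}^d$ be an $n$-dimensional simple lattice polytope, i.e. $P$ is a polytope of dimension $n$ all of whose vertices lie in $\mathbb{Z}^d$ and each of whose vertices lies on exactly $n$ edges. Let $\mathcal F_p(P)$ be the set of $p$-dimensional faces of $P$ (with $\mathcal F_n(P)=\{P\}$). For a face $F$ let $\mathrm{Vol}_{\mathbb Z}(F)$ be its lattice volume, i.e. the volume in the affine hull of $F$, normalized so that a fundamental parallelepiped of the lattice of integral vectors parallel to this affine hull has volume $(\dim F)!$. Put $$c(P)=\sum_{p=0}^n(-1)^{n-p}(p+1)\sum_{F\in\mathcal F_p(P)}\mathrm{Vol}_{\mathbb Z}(F),$$ and for $i\ge 1$ let $I_p(i)=\sum_{F\in\mathcal F_p(P)}\#\big(\operatorname{relint}(iF)\cap\mathbb{Z}^d\big)$ be the number of integral points in the relative interiors of the $i$-th dilates of the $p$-dimensional faces of $P$. If $n$ is odd and $m=(n+1)/2$, then $$c(P)=\sum_{p=m}^n\ \sum_{i=1}^{p+1-m}(-1)^{m-i}\binom{p+1}{m+i}\,2\,i\,I_p(i).$$ If $n$ is even and $m=n/2$, then $$c(P)=\sum_{p=m}^n\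 \sum_{i=1}^{p+1-m}(-1)^{m+1-i}\left(\binom{p+1}{m+i}-\binom{p+1}{m+i+1}\right) i\,I_p(i).$$ -/

import Mathlib

open scoped Pointwise

/-- The lattice `ℤ^d` inside `ℝ^d`. -/
def intLattice (d : ℕ) : Submodule ℤ (Fin d → ℝ) where
  carrier := {x | ∀ j, ∃ k : ℤ, (k : ℝ) = x j}
  zero_mem' := fun _ => ⟨0, by simp⟩
  add_mem' := by
    intro a b ha hb j
    obtain ⟨k, hk⟩ := ha j
    obtain ⟨l, hl⟩ := hb j
    exact ⟨k + l, by simp [hk, hl]⟩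
  smul_mem' := by
    intro c x hx j
    obtain ⟨k, hk⟩ := hx j
    exact ⟨c * k, by simp [hk]⟩

/-- A lattice polytope: the convex hull of a nonempty finite set of points of `ℝ^d`, all of whose
vertices (extreme points) lie in `ℤ^d`. -/
structure IsLatticePolytope {d : ℕ} (P : Set (Fin d → ℝ)) : Prop where
  exists_hull : ∃ S : Set (Fin d → ℝ), S.Finite ∧ S.Nonempty ∧ P = convexHull ℝ S
  vertices_integral : ∀ v ∈ P.extremePoints ℝ, v ∈ intLattice d

/-- The dimension of a (nonempty) convex set: the dimension of its affine hull. -/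
noncomputable def polyDim {d : ℕ} (P : Set (Fin d → ℝ)) : ℕ :=
  Module.finrank ℝ (vectorSpan ℝ P)

/-- The set of `p`-dimensional faces of `P`. A face is a nonempty subset of `P` on which some
linear functional attains its maximum over `P`; the zero functional gives `P` itself. -/
def faces {d : ℕ} (P : Set (Fin d → ℝ)) (p : ℕ) : Set (Set (Fin d → ℝ)) :=
  {F | F.Nonempty ∧ IsExposed ℝ P F ∧ polyDim F = p}

/-- A polytope is simple if each of its vertices lies on exactly `dim P` edges. -/
def IsSimplePolytope {d : ℕ} (P : Set (Fin d → ℝ)) : Prop :=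
  ∀ v ∈ P.extremePoints ℝ, {F ∈ faces P 1 | v ∈ F}.encard = (polyDim P : ℕ∞)

/-- The lattice `W ∩ ℤ^d` in the linear subspace `W` parallel to the affine hull of `F`. -/
def directionLattice {d : ℕ} (F : Set (Fin d → ℝ)) : Submodule ℤ (vectorSpan ℝ F) :=
  (intLattice d).comap ((vectorSpan ℝ F).subtype.restrictScalars ℤ)

open Classical in
/-- The lattice volume `Vol_ℤ(F)`: translate `F` by one of its points into the linear subspace `W`
parallel to its affine hull, and take there the translation-invariant volume normalized so that a
fundamental parallelepiped of `W ∩ ℤ^d` has volume `(dim F)!`. (The quotient of the Haar measure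
by the covolume does not depend on the choice of the Haar measure on `W`.) -/
noncomputable def latticeVolume {d : ℕ} (F : Set (Fin d → ℝ)) : ℝ :=
  if h : F.Nonempty then
    ((polyDim F).factorial : ℝ) *
      ((MeasureTheory.Measure.addHaar : MeasureTheory.Measure (vectorSpan ℝ F)).real
          {w | h.some + (w : Fin d → ℝ) ∈ F} /
        ZLattice.covolume (directionLattice F) MeasureTheory.Measure.addHaar)
  else 0

/-- The number `c(P) = ∑_{p=0}^n (-1)^{n-p} (p+1) ∑_{F ∈ 𝓕_p(P)} Vol_ℤ(F)`, where `n = dim P`. -/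
noncomputable def discriminantNumber {d : ℕ} (P : Set (Fin d → ℝ)) : ℝ :=
  ∑ p ∈ Finset.range (polyDim P + 1),
    (-1 : ℝ) ^ (polyDim P - p) * ((p : ℝ) + 1) * ∑ᶠ F ∈ faces P p, latticeVolume F

/-- `I_p(i)`: the number of lattice points in the relative interiors of the `i`-th dilates of the
`p`-dimensional faces of `P`. -/
noncomputable def interiorPoints {d : ℕ} (P : Set (Fin d → ℝ)) (p i : ℕ) : ℕ :=
  ∑ᶠ F ∈ faces P p, {x | x ∈ intLattice d ∧ x ∈ intrinsicInterior ℝ ((i : ℝ) • F)}.ncard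

/-! For a `p`-face `F` with Ehrhart polynomial `f`, put `g_F(t) = (-1)^p f(-t)`. By reciprocity it
counts interior points of `tF` for `t ≥ 1`, while `(-1)^p g_F(-t)` counts all lattice points of
`tF`. Its coefficient in degree `p` is `Vol_ℤ(F) / p!` (`latticeVolume_eq_coeff`). Let `g_p` be the
sum of `g_F` over the `p`-faces. Then `(p+1) ∑ Vol_ℤ(F)` is `(p+1)!` times the degree-`p`
coefficient of `g_p`, that is, the `(p+1)`-st finite difference of `X * g_p`, and the base point
`-m` of this difference is free.

The difference involves values at `-m, ..., p+1-m`. Positive arguments give `I_p(k)`, and the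
argument `0` contributes nothing because of the factor `X`. For a negative argument `-k`, decompose
each dilated face into relative interiors of its faces. In a simple polytope a `q`-face lies in
`(n-q).choose (n-p)` faces of dimension `p` (`IsSimplePolytope.ncard_faces`), so `(-1)^p g_p(-k) =
∑_q (n-q).choose (n-p) I_q(k)`. Taking the alternating sum over `p` collapses these binomials
(`sum_choose_mul_choose`). The resulting formula, `discriminantNumber_eq_sum`, holds for every `m ≤
n+1`; the theorem is the case where `-m` is at or next to the centre of symmetry.

Ehrhart reciprocity is proved on the cone over the polytope. A lexicographic triangulation is made
into a partition by half-open cells, where a point belongs to the cell entered by a small move in a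
generic direction `e`. With `e` a positive combination of the generators the cells partition the
cone, and with `-e` its relative interior. In one cell, `x ↦ 1 - x` on the fundamental box exchanges
kept and removed facets, which is reciprocity for a simplex. -/

/-! ### Ehrhart polynomials and reciprocity of half-open simplices -/

section HalfOpenSimplex

open Polynomial

/-- The polynomial `t ↦ (t - h + p choose p)`. -/
noncomputable def simplexPoly (p h : ℕ) : ℝ[X] :=
  C ((p.factorial : ℝ)⁻¹) * ∏ j ∈ Finset.range p, (X + C ((j : ℝ) + 1 - h))

lemma simplexPoly_natDegree_le (p h : ℕ) : (simplexPoly p h).natDegree ≤ p := by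
  refine (natDegree_C_mul_le _ _).trans ((natDegree_prod_le _ _).trans ?_)
  simp only [natDegree_X_add_C]
  simp

lemma simplexPoly_eval (p h : ℕ) (x : ℝ) :
    (simplexPoly p h).eval x =
      (p.factorial : ℝ)⁻¹ * ∏ j ∈ Finset.range p, (x + ((j : ℝ) + 1 - h)) := by
  simp [simplexPoly, eval_prod]

/-- Reversing the order of the factors, `j ↦ p - 1 - j`, changes the sign of each of them. This is
reciprocity for a single translate of the orthant. -/
lemma simplexPoly_eval_neg {p h h' : ℕ} (hh : h + h' = p + 1) (x : ℝ) :
    (simplexPoly p h').eval x = (-1) ^ p * (simplexPoly p h).eval (-x) := by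
  rw [simplexPoly_eval, simplexPoly_eval, ← Finset.prod_range_reflect, mul_left_comm]
  congr 1
  have : ((-1 : ℝ)) ^ p = ∏ _j ∈ Finset.range p, (-1 : ℝ) := by simp
  rw [this, ← Finset.prod_mul_distrib]
  refine Finset.prod_congr rfl fun j hj => ?_
  have h1 : p - 1 - j + j + 1 = p := by have := Finset.mem_range.1 hj; omega
  have h2 : ((p - 1 - j : ℕ) : ℝ) = p - 1 - j := by
    rw [eq_sub_iff_add_eq, eq_sub_iff_add_eq]; exact_mod_cast h1
  have h3 : (h : ℝ) + h' = p + 1 := by exact_mod_cast hh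
  rw [h2]
  linear_combination -h3

/-- Stars and bars. For `t < h` there are no solutions, and the polynomial must vanish too: its
factor with `j = h - t - 1` does, an index below `p` because `h ≤ p + 1` and `1 ≤ t`. -/
lemma card_nat_sum_eq {ι : Type*} [Fintype ι] {p h t : ℕ} (hι : Fintype.card ι = p + 1)
    (hh : h ≤ p + 1) (ht : 1 ≤ t) :
    (Nat.card {n : ι → ℕ // h + ∑ i, n i = t} : ℝ) = (simplexPoly p h).eval (t : ℝ) := by
  classical
  rw [simplexPoly_eval]
  rcases lt_or_ge t h with hlt | hle
  · have : IsEmpty {n : ι → ℕ // h + ∑ i, n i = t} := ⟨fun n => by have := n.2; omega⟩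
    rw [Nat.card_of_isEmpty, Finset.prod_eq_zero (i := h - t - 1)]
    · simp
    · rw [Finset.mem_range]; omega
    · have h1 : h - t - 1 + t + 1 = h := by omega
      have h2 : ((h - t - 1 : ℕ) : ℝ) + t + 1 = h := by exact_mod_cast h1
      linear_combination h2
  · obtain ⟨k, rfl⟩ := Nat.exists_eq_add_of_le hle
    have e : {n : ι → ℕ // h + ∑ i, n i = h + k} ≃ Sym ι k :=
      (Equiv.subtypeEquivRight fun n => by simp).trans (Sym.equivNatSumOfFintype ι k).symm
    rw [Nat.card_congr e, Nat.card_eq_fintype_card, Sym.card_sym_eq_choose, hι]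
    have h1 : p + 1 + k - 1 = k + p := by omega
    have h2 : (k + p).choose k = (k + p).choose p := by
      rw [← Nat.choose_symm_add, add_comm]
    have h3 := Nat.ascFactorial_eq_factorial_mul_choose k p
    rw [Nat.ascFactorial_eq_prod_range] at h3
    have h4 : (∏ i ∈ Finset.range p, ((k : ℝ) + 1 + i)) = p.factorial * ((k + p).choose p) := by
      exact_mod_cast h3
    rw [h1, h2, eq_inv_mul_iff_mul_eq₀ (by positivity), ← h4]
    refine Finset.prod_congr rfl fun j _ => ?_
    push_cast
    ring

/-- The orthant with the facets indexed by `O` removed. -/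
def halfOpenOrthant {ι : Type*} (O : Set ι) : Set (ι → ℝ) :=
  {x | ∀ i, 0 ≤ x i ∧ (i ∈ O → 0 < x i)}

/-- The unit cube, half-open in each direction: the facet `x i = 0` is removed for `i ∈ O` and
the facet `x i = 1` for `i ∉ O`. -/
def halfOpenBox {ι : Type*} (O : Set ι) : Set (ι → ℝ) :=
  {x | ∀ i, 0 ≤ x i ∧ x i ≤ 1 ∧ (i ∈ O → 0 < x i) ∧ (i ∉ O → x i < 1)}

lemma one_sub_mem_halfOpenBox {ι : Type*} {O : Set ι} {x : ι → ℝ} (hx : x ∈ halfOpenBox O) :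
    1 - x ∈ halfOpenBox Oᶜ := by
  intro i
  obtain ⟨h0, h1, h2, h3⟩ := hx i
  refine ⟨by simpa using h1, by simpa using h0, fun h => by simpa using h3 h, fun h => ?_⟩
  simpa using h2 (not_not.1 h)

lemma one_sub_mem_halfOpenBox_compl {ι : Type*} {O : Set ι} {x : ι → ℝ}
    (hx : x ∈ halfOpenBox Oᶜ) : 1 - x ∈ halfOpenBox O := by
  simpa using one_sub_mem_halfOpenBox hx

/-- Coordinatewise integer parts: the floor where the box is `[0, 1)`, the ceiling minus one where
it is `(0, 1]`. -/
lemma exists_box_decomposition {ι : Type*} {O : Set ι} {x : ι → ℝ} (hx : x ∈ halfOpenOrthant O) :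
    ∃ n : ι → ℕ, (fun i => x i - n i) ∈ halfOpenBox O := by
  classical
  have key : ∀ i, ∃ n : ℕ, 0 ≤ x i - n ∧ x i - n ≤ 1 ∧ (i ∈ O → 0 < x i - n) ∧
      (i ∉ O → x i - n < 1) := by
    intro i
    obtain ⟨h0, h1⟩ := hx i
    by_cases hi : i ∈ O
    · have hpos := h1 hi
      have hc := Nat.ceil_pos.2 hpos
      have hlt := Nat.ceil_lt_add_one h0
      have hle := Nat.le_ceil (x i)
      refine ⟨⌈x i⌉₊ - 1, ?_⟩
      rw [Nat.cast_sub hc, Nat.cast_one]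
      refine ⟨by linarith, by linarith, fun _ => by linarith, fun h => absurd hi h⟩
    · have := Nat.floor_le h0
      have h2 := Nat.lt_floor_add_one (x i)
      exact ⟨⌊x i⌋₊, by linarith, by linarith, fun h => absurd h hi, fun _ => by linarith⟩
  choose n hn using key
  exact ⟨n, hn⟩

lemma box_decomposition_unique {ι : Type*} {O : Set ι} {x y : ι → ℝ} {n m : ι → ℕ}
    (hx : x ∈ halfOpenBox O) (hy : y ∈ halfOpenBox O) (h : ∀ i, x i + n i = y i + m i) :
    x = y ∧ n = m := by
  have hnm : n = m := by
    funext i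
    obtain ⟨x0, x1, x2, x3⟩ := hx i
    obtain ⟨y0, y1, y2, y3⟩ := hy i
    have hi := h i
    have h1 : (n i : ℝ) < m i + 1 ∧ (m i : ℝ) < n i + 1 := by
      by_cases hO : i ∈ O
      · have := x2 hO; have := y2 hO; constructor <;> linarith
      · have := x3 hO; have := y3 hO; constructor <;> linarith
    have h2 : n i < m i + 1 := by exact_mod_cast h1.1
    have h3 : m i < n i + 1 := by exact_mod_cast h1.2
    omega
  refine ⟨?_, hnm⟩
  funext i
  have := h i
  rw [hnm] at this
  linarith

lemma natCast_mem_of_single_mem {ι : Type*} [Fintype ι] [DecidableEq ι] {Γ : AddSubgroup (ι → ℝ)}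
    (h1 : ∀ i, Pi.single i (1 : ℝ) ∈ Γ) (n : ι → ℕ) : (fun i => (n i : ℝ)) ∈ Γ := by
  have : (fun i => (n i : ℝ)) = ∑ i, n i • Pi.single i (1 : ℝ) := by
    funext j
    simp [Finset.sum_apply, Pi.single_apply]
  rw [this]
  exact sum_mem fun i _ => Γ.nsmul_mem (h1 i) _

/-- Lattice point enumeration in the dilates of a half-open simplex. -/
lemma card_halfOpenOrthant_eq {ι : Type*} [Fintype ι] [DecidableEq ι] {p : ℕ}
    (hι : Fintype.card ι = p + 1)
    {Γ : AddSubgroup (ι → ℝ)} (h1 : ∀ i, Pi.single i (1 : ℝ) ∈ Γ) (O : Set ι)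
    [Fintype {x // x ∈ Γ ∧ x ∈ halfOpenBox O}]
    (ht : {x // x ∈ Γ ∧ x ∈ halfOpenBox O} → ℕ) (hht : ∀ x, ∑ i, x.1 i = ht x)
    {t : ℕ} (htpos : 1 ≤ t) :
    (Nat.card {x : ι → ℝ // x ∈ Γ ∧ x ∈ halfOpenOrthant O ∧ ∑ i, x i = t} : ℝ) =
      ∑ x, (simplexPoly p (ht x)).eval (t : ℝ) := by
  let B := {x // x ∈ Γ ∧ x ∈ halfOpenBox O}
  let f : (Σ x : B, {n : ι → ℕ // ht x + ∑ i, n i = t}) →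
      {x : ι → ℝ // x ∈ Γ ∧ x ∈ halfOpenOrthant O ∧ ∑ i, x i = t} := fun z =>
    ⟨z.1.1 + fun i => (z.2.1 i : ℝ), Γ.add_mem z.1.2.1 (natCast_mem_of_single_mem h1 _), by
      intro i
      obtain ⟨a0, a1, a2, a3⟩ := z.1.2.2 i
      have : (0 : ℝ) ≤ z.2.1 i := Nat.cast_nonneg _
      simp only [Pi.add_apply]
      exact ⟨by linarith, fun h => by linarith [a2 h]⟩, by
      have := z.2.2
      simp only [Pi.add_apply, Finset.sum_add_distrib]
      rw [hht]
      exact_mod_cast this⟩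
  have hf : Function.Bijective f := by
    constructor
    · rintro ⟨x, n, hn⟩ ⟨y, m, hm⟩ h
      have h' := congrArg Subtype.val h
      obtain ⟨hxy, hnm⟩ := box_decomposition_unique x.2.2 y.2.2
        (fun i => congrFun h' i : ∀ i, x.1 i + n i = y.1 i + m i)
      obtain rfl : x = y := Subtype.ext hxy
      subst hnm
      rfl
    · rintro ⟨x, hxΓ, hxO, hxt⟩
      obtain ⟨n, hn⟩ := exists_box_decomposition hxO
      have hmem : (fun i => x i - n i) ∈ Γ := Γ.sub_mem hxΓ (natCast_mem_of_single_mem h1 n)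
      refine ⟨⟨⟨_, hmem, hn⟩, n, ?_⟩, ?_⟩
      · have := hht ⟨_, hmem, hn⟩
        simp only [Finset.sum_sub_distrib, hxt] at this
        have h2 : ((ht ⟨_, hmem, hn⟩ : ℕ) : ℝ) + ((∑ i, n i : ℕ) : ℝ) = t := by
          push_cast; linarith
        exact_mod_cast h2
      · apply Subtype.ext
        funext i
        simp [f]
  have hfin : ∀ x : B, Finite {n : ι → ℕ // ht x + ∑ i, n i = t} := fun x => by
    refine Set.Finite.to_subtype ((Set.finite_Iic (fun _ : ι => t)).subset ?_)
    intro n hn i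
    have : n i ≤ ∑ i, n i := Finset.single_le_sum (fun _ _ => Nat.zero_le _) (Finset.mem_univ i)
    have hn' : ht x + ∑ i, n i = t := hn
    show n i ≤ t
    omega
  rw [← Nat.card_congr (Equiv.ofBijective f hf), Nat.card_sigma, Nat.cast_sum]
  refine Finset.sum_congr rfl fun x _ => card_nat_sum_eq hι ?_ htpos
  -- A box point has height at most `p + 1`, the bound needed for the polynomial count to be valid
  -- from `t = 1` on.
  have : ∑ i, x.1 i ≤ ∑ _i : ι, (1 : ℝ) := Finset.sum_le_sum fun i _ => (x.2.2 i).2.1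
  rw [hht, Finset.sum_const, Finset.card_univ, hι, nsmul_eq_mul, mul_one] at this
  exact_mod_cast this

/-- Ehrhart polynomial and reciprocity for half-open simplices in barycentric coordinates. -/
theorem exists_ehrhart_halfOpenOrthant {ι : Type*} [Fintype ι] [DecidableEq ι] {p : ℕ}
    (hι : Fintype.card ι = p + 1) (Γ : AddSubgroup (ι → ℝ)) (h1 : ∀ i, Pi.single i (1 : ℝ) ∈ Γ)
    (h2 : ∀ x ∈ Γ, ∃ k : ℤ, ∑ i, x i = k)
    (h3 : {x | x ∈ Γ ∧ ∀ i, 0 ≤ x i ∧ x i ≤ 1}.Finite) (O : Set ι) :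
    ∃ f : ℝ[X], f.natDegree ≤ p ∧ ∀ t : ℕ, 1 ≤ t →
      f.eval (t : ℝ) =
        Nat.card {x : ι → ℝ // x ∈ Γ ∧ x ∈ halfOpenOrthant O ∧ ∑ i, x i = t} ∧
      (-1) ^ p * f.eval (-(t : ℝ)) =
        Nat.card {x : ι → ℝ // x ∈ Γ ∧ x ∈ halfOpenOrthant Oᶜ ∧ ∑ i, x i = t} := by
  classical
  have hfin : ∀ O : Set ι, Finite {x // x ∈ Γ ∧ x ∈ halfOpenBox O} := fun O =>
    Set.Finite.to_subtype (h3.subset fun x hx => ⟨hx.1, fun i => ⟨(hx.2 i).1, (hx.2 i).2.1⟩⟩)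
  have hnat : ∀ O : Set ι, ∀ x : {x // x ∈ Γ ∧ x ∈ halfOpenBox O}, ∃ k : ℕ, ∑ i, x.1 i = k := by
    intro O x
    obtain ⟨k, hk⟩ := h2 x.1 x.2.1
    have h0 : (0 : ℝ) ≤ ∑ i, x.1 i := Finset.sum_nonneg fun i _ => (x.2.2 i).1
    rw [hk] at h0
    lift k to ℕ using by exact_mod_cast h0
    exact ⟨k, by simpa using hk⟩
  choose ht hht using hnat
  have := fun O => Fintype.ofFinite {x // x ∈ Γ ∧ x ∈ halfOpenBox O}
  refine ⟨∑ x, simplexPoly p (ht O x),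
    natDegree_sum_le_of_forall_le _ _ fun x _ => simplexPoly_natDegree_le _ _, fun t htpos =>
    ⟨?_, ?_⟩⟩
  · rw [card_halfOpenOrthant_eq hι h1 O (ht O) (hht O) htpos, eval_finsetSum]
  · rw [card_halfOpenOrthant_eq hι h1 Oᶜ (ht Oᶜ) (hht Oᶜ) htpos, eval_finsetSum, Finset.mul_sum]
    have hone : (1 : ι → ℝ) ∈ Γ := by
      have := natCast_mem_of_single_mem h1 (fun _ => 1)
      simpa [Pi.one_def] using this
    -- The reflection sends height `h` to `p + 1 - h`, matching the symmetry of `simplexPoly`.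
    let e : {x // x ∈ Γ ∧ x ∈ halfOpenBox O} ≃ {x // x ∈ Γ ∧ x ∈ halfOpenBox Oᶜ} :=
      { toFun := fun x => ⟨1 - x.1, Γ.sub_mem hone x.2.1, one_sub_mem_halfOpenBox x.2.2⟩
        invFun := fun x => ⟨1 - x.1, Γ.sub_mem hone x.2.1, one_sub_mem_halfOpenBox_compl x.2.2⟩
        left_inv := fun x => Subtype.ext (by simp)
        right_inv := fun x => Subtype.ext (by simp) }
    refine Fintype.sum_equiv e _ _ fun x => (simplexPoly_eval_neg ?_ _).symm
    have h4 := hht Oᶜ (e x)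
    have h5 : ∑ i, (e x).1 i = (p + 1 : ℝ) - ∑ i, x.1 i := by
      simp [e, Finset.sum_sub_distrib, hι]
    rw [h5, hht O x] at h4
    have : (ht O x : ℝ) + ht Oᶜ (e x) = p + 1 := by linarith
    exact_mod_cast this

end HalfOpenSimplex

/-! ### Lexicographic triangulations of cones and their half-open cells -/

section LexTriangulation

open Filter Topology

/-- A vector is lexicographically nonnegative along a list of coordinates if its first nonzero
entry along the list, if there is one, is positive. -/
def LexNonneg {ι : Type*} : List ι → (ι → ℝ) → Prop
  | [], _ => True
  | i :: l, x => 0 < x i ∨ (x i = 0 ∧ LexNonneg l x)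

lemma LexNonneg.eq_zero {ι : Type*} {l : List ι} {x : ι → ℝ} (h : LexNonneg l x)
    (h' : LexNonneg l (-x)) : ∀ i ∈ l, x i = 0 := by
  induction l with
  | nil => simp
  | cons j l ih =>
    simp only [LexNonneg, Pi.neg_apply] at h h'
    rcases h with h | ⟨h, hl⟩
    · rcases h' with h' | ⟨h', -⟩ <;> linarith
    · rcases h' with h' | ⟨-, hl'⟩
      · linarith
      · intro i hi
        rcases List.mem_cons.1 hi with rfl | hi
        · exact h
        · exact ih hl hl' i hi

lemma LexNonneg.of_smul {ι : Type*} {l : List ι} {x : ι → ℝ} {c : ℝ} (hc : 0 < c)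
    (h : LexNonneg l (c • x)) : LexNonneg l x := by
  induction l with
  | nil => trivial
  | cons j l ih =>
    simp only [LexNonneg, Pi.smul_apply, smul_eq_mul] at h ⊢
    rcases h with h | ⟨h, hl⟩
    · exact Or.inl (pos_of_mul_pos_right h hc.le)
    · exact Or.inr ⟨(mul_eq_zero.1 h).resolve_left hc.ne', ih hl⟩

lemma IsCompact.exists_lexMin {ι : Type*} (l : List ι) {K : Set (ι → ℝ)} (hK : IsCompact K)
    (hne : K.Nonempty) : ∃ x ∈ K, ∀ y ∈ K, LexNonneg l (y - x) := by
  induction l generalizing K with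
  | nil => exact ⟨_, hne.some_mem, fun _ _ => trivial⟩
  | cons j l ih =>
    obtain ⟨z, hz, hmin⟩ := hK.exists_isMinOn hne (continuous_apply j).continuousOn
    obtain ⟨x, hx, hx'⟩ := ih (K := K ∩ {x | x j = z j})
      (hK.inter_right (isClosed_eq (continuous_apply j) continuous_const)) ⟨z, hz, rfl⟩
    refine ⟨x, hx.1, fun y hy => ?_⟩
    have h1 : z j ≤ y j := hmin hy
    have h2 : x j = z j := hx.2
    simp only [LexNonneg, Pi.sub_apply]
    rcases h1.lt_or_eq with h | h
    · left; linarith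
    · exact Or.inr ⟨by linarith, hx' y ⟨hy, h.symm⟩⟩

lemma eventually_add_mul_pos {a : ℝ} (b : ℝ) (ha : 0 < a) : ∀ᶠ ε in 𝓝[>] (0 : ℝ), 0 < a + ε * b := by
  have : Tendsto (fun ε : ℝ => a + ε * b) (𝓝[>] 0) (𝓝 a) := by
    have h : Continuous fun ε : ℝ => a + ε * b := by fun_prop
    have := (h.tendsto 0).mono_left (nhdsWithin_le_nhds (s := Set.Ioi 0))
    simpa using this
  exact this.eventually_const_lt ha

/-- A line with direction outside `H` meets `H` for at most one parameter. -/
lemma eventually_add_smul_notMem {V : Type*} [AddCommGroup V] [Module ℝ V] {H : Submodule ℝ V}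
    {e : V} (he : e ∉ H) (y : V) : ∀ᶠ ε in 𝓝[>] (0 : ℝ), y + ε • e ∉ H := by
  by_cases hex : ∃ δ : ℝ, y + δ • e ∈ H
  · obtain ⟨δ, hδ⟩ := hex
    have : ∀ ε : ℝ, y + ε • e ∈ H → ε = δ := by
      intro ε hε
      by_contra hne
      apply he
      have h1 : (ε - δ) • e ∈ H := by
        have := H.sub_mem hε hδ
        simpa [sub_smul] using this
      exact (H.smul_mem_iff (sub_ne_zero.2 hne)).1 h1
    rcases le_or_gt δ 0 with hδ0 | hδ0
    · filter_upwards [self_mem_nhdsWithin] with ε hε hmem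
      have h2 := this ε hmem
      have h3 : (0 : ℝ) < ε := hε
      linarith
    · filter_upwards [Ioo_mem_nhdsGT hδ0] with ε hε hmem
      exact hε.2.ne (this ε hmem)
  · push Not at hex
    exact Eventually.of_forall hex

variable {V ι : Type*} [NormedAddCommGroup V] [NormedSpace ℝ V] [Fintype ι]

/-- The convex cone generated by a finite family of vectors. -/
def genCone (q : ι → V) : Set V := {y | ∃ c : ι → ℝ, (∀ i, 0 ≤ c i) ∧ ∑ i, c i • q i = y}

lemma genCone_add_mem {q : ι → V} {y z : V} (hy : y ∈ genCone q) (hz : z ∈ genCone q) :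
    y + z ∈ genCone q := by
  obtain ⟨c, hc, rfl⟩ := hy
  obtain ⟨c', hc', rfl⟩ := hz
  exact ⟨c + c', fun i => add_nonneg (hc i) (hc' i), by
    simp [add_smul, Finset.sum_add_distrib]⟩

lemma genCone_smul_mem {q : ι → V} {y : V} {r : ℝ} (hr : 0 ≤ r) (hy : y ∈ genCone q) :
    r • y ∈ genCone q := by
  obtain ⟨c, hc, rfl⟩ := hy
  exact ⟨r • c, fun i => mul_nonneg hr (hc i), by simp [Finset.smul_sum, mul_smul]⟩

lemma sum_eq_sum_coe {M : Type*} [AddCommMonoid M] {A : Set ι} [Fintype A] {f : ι → M}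
    (hf : ∀ i ∉ A, f i = 0) : ∑ i, f i = ∑ i : A, f i := by
  classical
  rw [← Finset.sum_subtype (Finset.univ.filter (· ∈ A)) (by simp) f]
  refine (Finset.sum_filter_of_ne fun i _ hi => ?_).symm
  by_contra h
  exact hi (hf i h)

lemma sum_smul_mem_span {q : ι → V} {A : Set ι} {c : ι → ℝ} (hc : ∀ i ∉ A, c i = 0) :
    ∑ i, c i • q i ∈ Submodule.span ℝ (q '' A) := by
  refine sum_mem fun i _ => ?_
  by_cases hi : i ∈ A
  · exact Submodule.smul_mem _ _ (Submodule.subset_span ⟨i, hi, rfl⟩)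
  · rw [hc i hi, zero_smul]; exact zero_mem _

lemma exists_sum_smul_of_mem_span {q : ι → V} {A : Set ι} {y : V}
    (hy : y ∈ Submodule.span ℝ (q '' A)) :
    ∃ c : ι → ℝ, (∀ i ∉ A, c i = 0) ∧ ∑ i, c i • q i = y := by
  rw [Finsupp.mem_span_image_iff_linearCombination] at hy
  obtain ⟨c, hc, rfl⟩ := hy
  refine ⟨c, fun i hi => ?_, ?_⟩
  · by_contra h
    exact hi (hc (Finsupp.mem_support_iff.2 h))
  · rw [Finsupp.linearCombination_apply, Finsupp.sum_fintype _ _ (by simp)]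

lemma mem_span_of_mem_genCone {q : ι → V} {y : V} (hy : y ∈ genCone q) :
    y ∈ Submodule.span ℝ (Set.range q) := by
  obtain ⟨c, -, rfl⟩ := hy
  exact sum_mem fun i _ => Submodule.smul_mem _ _ (Submodule.subset_span ⟨i, rfl⟩)

/-- A set `A` of indices supports lexicographically minimal combinations: every linear relation
that is nonnegative off `A` is lexicographically nonnegative. -/
def IsLexMinSupport (q : ι → V) (A : Set ι) : Prop :=
  ∀ μ : ι → ℝ, ∑ i, μ i • q i = 0 → (∀ i ∉ A, 0 ≤ μ i) → LexNonneg Finset.univ.toList μ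

/-- The difference of the two coefficient vectors is a relation that is nonnegative off `A`, and its
negative is nonnegative off `B`; lexicographic nonnegativity in both directions forces it to vanish.
This is what makes cells with distinct supports overlap only along common faces. -/
lemma IsLexMinSupport.unique {q : ι → V} {A B : Set ι} (hA : IsLexMinSupport q A)
    (hB : IsLexMinSupport q B) {c c' : ι → ℝ} (hc : ∀ i ∉ A, c i = 0) (hc' : ∀ i ∉ B, c' i = 0)
    (h0 : ∀ i ∉ B, 0 ≤ c i) (h0' : ∀ i ∉ A, 0 ≤ c' i) (h : ∑ i, c i • q i = ∑ i, c' i • q i) :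
    c = c' := by
  have h1 : LexNonneg Finset.univ.toList (c' - c) := by
    refine hA _ (by simp [sub_smul, Finset.sum_sub_distrib, h]) fun i hi => ?_
    simpa [hc i hi] using h0' i hi
  have h2 : LexNonneg Finset.univ.toList (-(c' - c)) := by
    rw [neg_sub]
    refine hB _ (by simp [sub_smul, Finset.sum_sub_distrib, h]) fun i hi => ?_
    simpa [hc' i hi] using h0 i hi
  funext i
  have := h1.eq_zero h2 i (by simp)
  simp only [Pi.sub_apply] at this
  linarith

lemma IsLexMinSupport.coeff_unique {q : ι → V} {A : Set ι} (hA : IsLexMinSupport q A)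
    {c c' : ι → ℝ} (hc : ∀ i ∉ A, c i = 0) (hc' : ∀ i ∉ A, c' i = 0)
    (h : ∑ i, c i • q i = ∑ i, c' i • q i) : c = c' :=
  hA.unique hA hc hc' (fun i hi => (hc i hi).ge) (fun i hi => (hc' i hi).ge) h

/-- The nonnegative representations of `y` form a compact set, since each coefficient is at most `h
y`. The support of the lexicographically least one works: a relation that is nonnegative off the
support can be added with a small factor without losing nonnegativity. -/
lemma exists_isLexMinSupport {q : ι → V} (h : V →L[ℝ] ℝ) (hq : ∀ i, h (q i) = 1) {y : V}
    (hy : y ∈ genCone q) : ∃ A, IsLexMinSupport q A ∧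
      ∃ c : ι → ℝ, (∀ i, 0 ≤ c i) ∧ (∀ i ∉ A, c i = 0) ∧ ∑ i, c i • q i = y := by
  classical
  let K : Set (ι → ℝ) := {c | (∀ i, 0 ≤ c i) ∧ ∑ i, c i • q i = y}
  have hK : IsCompact K := by
    have hcl : IsClosed K := by
      have h1 : IsClosed {c : ι → ℝ | ∀ i, 0 ≤ c i} := by
        simp only [Set.ofPred_forall]
        exact isClosed_iInter fun i => isClosed_le continuous_const (continuous_apply i)
      exact h1.inter (isClosed_eq (by fun_prop) continuous_const)
    refine (isCompact_Icc (a := (0 : ι → ℝ)) (b := fun _ => h y)).of_isClosed_subset hcl ?_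
    rintro c ⟨hc, hcy⟩
    refine ⟨hc, fun i => ?_⟩
    have : h y = ∑ i, c i := by rw [← hcy]; simp [hq]
    show c i ≤ h y
    rw [this]
    exact Finset.single_le_sum (fun j _ => hc j) (Finset.mem_univ i)
  obtain ⟨c, ⟨hc0, hcy⟩, hmin⟩ := hK.exists_lexMin Finset.univ.toList (K := K) hy
  refine ⟨{i | c i ≠ 0}, fun μ hμ hμ0 => ?_, c, hc0, fun i hi => not_not.1 hi, hcy⟩
  have hev : ∀ᶠ ε in 𝓝[>] (0 : ℝ), ∀ i, 0 ≤ c i + ε * μ i := by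
    refine eventually_all.2 fun i => ?_
    rcases (hc0 i).lt_or_eq with hi | hi
    · exact (eventually_add_mul_pos _ hi).mono fun _ => le_of_lt
    · filter_upwards [self_mem_nhdsWithin] with ε hε
      have h1 : 0 ≤ μ i := hμ0 i (by simp [← hi])
      rw [← hi, zero_add]
      exact mul_nonneg (le_of_lt hε) h1
  obtain ⟨ε, hε, hε0⟩ := (hev.and self_mem_nhdsWithin).exists
  have := hmin (c + ε • μ) ⟨hε, by
    simp only [Pi.add_apply, Pi.smul_apply, smul_eq_mul, add_smul, Finset.sum_add_distrib, hcy,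
      mul_smul, ← Finset.smul_sum, hμ, smul_zero, add_zero]⟩
  rw [add_sub_cancel_left] at this
  exact this.of_smul hε0

lemma IsLexMinSupport.linearIndependent {q : ι → V} {A : Set ι} (hA : IsLexMinSupport q A) :
    LinearIndependent ℝ (fun i : A => q i) := by
  classical
  rw [Fintype.linearIndependent_iff]
  intro g hg i
  let c : ι → ℝ := fun i => if h : i ∈ A then g ⟨i, h⟩ else 0
  have hc : ∀ i ∉ A, c i = 0 := fun i hi => by simp [c, hi]
  have hsum : ∑ i, c i • q i = ∑ i, (0 : ι → ℝ) i • q i := by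
    simp only [Pi.zero_apply, zero_smul, Finset.sum_const_zero]
    rw [← hg, sum_eq_sum_coe (A := A) fun i hi => by rw [hc i hi, zero_smul]]
    exact Finset.sum_congr rfl fun i _ => by simp [c]
  have := congrFun (hA.coeff_unique hc (fun _ _ => rfl) hsum) i
  simpa [c] using this

/-- The direction `e` avoids the span of every subfamily of `q` that does not span everything. -/
def IsGenericDirection (q : ι → V) (e : V) : Prop :=
  e ∈ Submodule.span ℝ (Set.range q) ∧ ∀ A : Set ι,
    Submodule.span ℝ (q '' A) ≠ Submodule.span ℝ (Set.range q) → e ∉ Submodule.span ℝ (q '' A)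

lemma IsGenericDirection.neg {κ : Type*} {q : κ → V} {e : V} (he : IsGenericDirection q e) :
    IsGenericDirection q (-e) :=
  ⟨neg_mem he.1, fun A hA h => he.2 A hA (by simpa using neg_mem h)⟩

/-- The index sets of the maximal cells of the lexicographic triangulation. -/
def maxCells (q : ι → V) : Set (Set ι) :=
  {A | IsLexMinSupport q A ∧ Submodule.span ℝ (q '' A) = Submodule.span ℝ (Set.range q)}

/-- The maximal cell `A`, with those facets removed that are left when moving in direction `e`. -/
def halfOpenCell (q : ι → V) (e : V) (A : Set ι) : Set V :=
  {y | ∃ b c : ι → ℝ, (∀ i ∉ A, b i = 0) ∧ (∀ i ∉ A, c i = 0) ∧ ∑ i, b i • q i = e ∧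
    ∑ i, c i • q i = y ∧ ∀ i ∈ A, 0 ≤ c i ∧ (b i < 0 → 0 < c i)}

/-- Otherwise `e` would lie in the span of `A` without `i`, a proper subspace by independence. Hence
`e` is never parallel to a facet of a maximal cell. -/
lemma IsGenericDirection.coeff_ne_zero {q : ι → V} {e : V} (he : IsGenericDirection q e)
    {A : Set ι} (hA : A ∈ maxCells q) {b : ι → ℝ} (hb : ∀ i ∉ A, b i = 0)
    (hbe : ∑ i, b i • q i = e) {i : ι} (hi : i ∈ A) : b i ≠ 0 := by
  classical
  intro h0
  have h1 : e ∈ Submodule.span ℝ (q '' (A \ {i})) := by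
    rw [← hbe]
    refine sum_smul_mem_span fun j hj => ?_
    by_cases hjA : j ∈ A
    · have : j = i := by by_contra h; exact hj ⟨hjA, h⟩
      rw [this, h0]
    · exact hb j hjA
  refine he.2 _ (fun h2 => ?_) h1
  have h3 : q i ∈ Submodule.span ℝ (q '' (A \ {i})) := by
    rw [h2]; exact Submodule.subset_span ⟨i, rfl⟩
  obtain ⟨c, hc, hcq⟩ := exists_sum_smul_of_mem_span h3
  have h4 := hA.1.coeff_unique (c := c) (c' := Pi.single i 1)
    (fun j hj => hc j fun h => hj h.1)
    (fun j hj => Pi.single_eq_of_ne (by rintro rfl; exact hj hi) _) (by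
      rw [hcq, Finset.sum_eq_single i] <;> simp +contextual)
  have h5 := congrFun h4 i
  rw [hc i (fun h => h.2 rfl), Pi.single_eq_same] at h5
  exact zero_ne_one h5

/-- Finitely many proper subspaces do not cover the coefficient space. A coefficient vector avoiding
them, added with a small factor to the all-ones vector, keeps all coefficients positive. -/
lemma exists_generic_interior (q : ι → V) :
    ∃ w : ι → ℝ, (∀ i, 0 < w i) ∧ IsGenericDirection q (∑ i, w i • q i) := by
  classical
  let T : (ι → ℝ) →ₗ[ℝ] V := Fintype.linearCombination ℝ q
  have hT : ∀ c, T c = ∑ i, c i • q i := fun c => Fintype.linearCombination_apply ℝ q c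
  let 𝒜 : Set (Set ι) :=
    {A | Submodule.span ℝ (q '' A) ≠ Submodule.span ℝ (Set.range q)}
  have hex : ∃ x : ι → ℝ, ∀ A ∈ 𝒜, T x ∉ Submodule.span ℝ (q '' A) := by
    by_contra hcon
    push Not at hcon
    refine Subspace.biUnion_ne_univ_of_top_notMem (k := ℝ) (E := ι → ℝ)
      (s := (Set.toFinite 𝒜).toFinset.image fun A => (Submodule.span ℝ (q '' A)).comap T) ?_ ?_
    · intro htop
      simp only [Finset.mem_image, Set.Finite.mem_toFinset] at htop
      obtain ⟨A, hA, hAt⟩ := htop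
      refine hA (le_antisymm (Submodule.span_mono (Set.image_subset_range _ _)) ?_)
      rw [Submodule.span_le]
      rintro _ ⟨i, rfl⟩
      have : (Pi.single i (1 : ℝ) : ι → ℝ) ∈ (Submodule.span ℝ (q '' A)).comap T := by
        rw [hAt]; trivial
      simpa [T, Fintype.linearCombination_apply_single] using this
    · rw [Set.eq_univ_iff_forall]
      intro x
      obtain ⟨A, hA, hx⟩ := hcon x
      simp only [Set.mem_iUnion, Finset.mem_image, Set.Finite.mem_toFinset]
      exact ⟨_, ⟨A, hA, rfl⟩, hx⟩
  obtain ⟨x, hx⟩ := hex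
  have hev : ∀ᶠ ε in 𝓝[>] (0 : ℝ), (∀ i, 0 < 1 + ε * x i) ∧
      ∀ A : Set ι, A ∈ 𝒜 → T 1 + ε • T x ∉ Submodule.span ℝ (q '' A) := by
    refine (eventually_all.2 fun i => eventually_add_mul_pos _ one_pos).and
      (eventually_all.2 fun A => ?_)
    by_cases hA : A ∈ 𝒜
    · exact (eventually_add_smul_notMem (hx A hA) _).mono fun _ h _ => h
    · exact Eventually.of_forall fun _ h => absurd h hA
  obtain ⟨ε, hε1, hε2⟩ := hev.exists
  refine ⟨fun i => 1 + ε * x i, hε1, ?_, fun A hA => ?_⟩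
  · exact sum_mem fun i _ => Submodule.smul_mem _ _ (Submodule.subset_span ⟨i, rfl⟩)
  · have := hε2 A hA
    rwa [← map_smul, ← map_add, hT] at this

lemma eventually_of_mem_halfOpenCell {q : ι → V} {e : V} (he : IsGenericDirection q e) {A : Set ι}
    (hA : A ∈ maxCells q) {y : V} (hy : y ∈ halfOpenCell q e A) :
    ∀ᶠ ε in 𝓝[>] (0 : ℝ), ∃ c : ι → ℝ, (∀ i ∉ A, c i = 0) ∧ (∀ i ∈ A, 0 < c i) ∧
      ∑ i, c i • q i = y + ε • e := by
  obtain ⟨b, c, hb, hc, hbe, hcy, hcb⟩ := hy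
  have h1 : ∀ᶠ ε in 𝓝[>] (0 : ℝ), ∀ i : ι, i ∈ A → 0 < c i + ε * b i := by
    refine eventually_all.2 fun i => ?_
    by_cases hi : i ∈ A
    · obtain ⟨h0, h1⟩ := hcb i hi
      rcases h0.lt_or_eq with h | h
      · exact (eventually_add_mul_pos _ h).mono fun _ h _ => h
      · have hbi : 0 < b i := by
          rcases lt_trichotomy (b i) 0 with h' | h' | h'
          · exact absurd (h1 h') (by simp [← h])
          · exact absurd h' (he.coeff_ne_zero hA hb hbe hi)
          · exact h'
        filter_upwards [self_mem_nhdsWithin] with ε hε _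
        rw [← h, zero_add]
        exact mul_pos hε hbi
    · exact Eventually.of_forall fun _ h => absurd h hi
  filter_upwards [h1] with ε hε
  refine ⟨fun i => c i + ε * b i, fun i hi => by simp [hb i hi, hc i hi], hε, ?_⟩
  simp only [add_smul, Finset.sum_add_distrib, mul_smul, ← Finset.smul_sum, hbe, hcy]

/-- For small `ε` the point `y + ε • e` avoids every non-spanning subfamily, so its lexicographic
support is a maximal cell. There are finitely many cells, so one of them recurs for arbitrarily
small `ε`. In it the coefficients are `c i + ε * b i`, and their nonnegativity gives the half-open
conditions. -/
lemma exists_mem_halfOpenCell {q : ι → V} (h : V →L[ℝ] ℝ) (hq : ∀ i, h (q i) = 1) {e : V}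
    (he : IsGenericDirection q e) {y : V} (hyU : y ∈ Submodule.span ℝ (Set.range q))
    (hy : ∀ᶠ ε in 𝓝[>] (0 : ℝ), y + ε • e ∈ genCone q) :
    ∃ A ∈ maxCells q, y ∈ halfOpenCell q e A := by
  classical
  have hgen : ∀ᶠ ε in 𝓝[>] (0 : ℝ), ∀ A : Set ι,
      Submodule.span ℝ (q '' A) ≠ Submodule.span ℝ (Set.range q) →
        y + ε • e ∉ Submodule.span ℝ (q '' A) := by
    refine eventually_all.2 fun A => ?_
    by_cases hA : Submodule.span ℝ (q '' A) = Submodule.span ℝ (Set.range q)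
    · exact Eventually.of_forall fun _ h => absurd hA h
    · exact (eventually_add_smul_notMem (he.2 A hA) y).mono fun _ h _ => h
  have h1 : ∀ᶠ ε in 𝓝[>] (0 : ℝ), ∃ A : Set ι, A ∈ maxCells q ∧
      ∃ c : ι → ℝ, (∀ i, 0 ≤ c i) ∧ (∀ i ∉ A, c i = 0) ∧ ∑ i, c i • q i = y + ε • e := by
    filter_upwards [hy, hgen] with ε hε hε'
    obtain ⟨A, hA, c, hc0, hcA, hc⟩ := exists_isLexMinSupport h hq hε
    refine ⟨A, ⟨hA, ?_⟩, c, hc0, hcA, hc⟩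
    by_contra hne
    exact hε' A hne (hc ▸ sum_smul_mem_span hcA)
  have h2 : ∃ A : Set ι, ∃ᶠ ε in 𝓝[>] (0 : ℝ), A ∈ maxCells q ∧
      ∃ c : ι → ℝ, (∀ i, 0 ≤ c i) ∧ (∀ i ∉ A, c i = 0) ∧ ∑ i, c i • q i = y + ε • e := by
    by_contra hcon
    simp only [not_exists, not_frequently] at hcon
    obtain ⟨ε, ⟨A, hA⟩, hε⟩ := (h1.and (eventually_all.2 hcon)).exists
    exact hε A hA
  obtain ⟨A, hfr⟩ := h2
  obtain ⟨_, hA, -⟩ := hfr.exists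
  have hspan : ∀ z ∈ Submodule.span ℝ (Set.range q), ∃ c : ι → ℝ, (∀ i ∉ A, c i = 0) ∧
      ∑ i, c i • q i = z := fun z hz => exists_sum_smul_of_mem_span (hA.2 ▸ hz)
  obtain ⟨b, hb, hbe⟩ := hspan e he.1
  obtain ⟨c, hc, hcy⟩ := hspan y hyU
  have hfr' : ∃ᶠ ε in 𝓝[>] (0 : ℝ), ∀ i, 0 ≤ c i + ε * b i := by
    refine hfr.mono fun ε ⟨_, c', hc0, hcA, hc'⟩ i => ?_
    have := hA.1.coeff_unique (c := fun i => c i + ε * b i) (c' := c')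
      (fun i hi => by simp [hb i hi, hc i hi]) hcA
      (by simp only [add_smul, Finset.sum_add_distrib, mul_smul, ← Finset.smul_sum, hbe, hcy, hc'])
    have h3 := hc0 i
    rwa [← congrFun this i] at h3
  refine ⟨A, hA, b, c, hb, hc, hbe, hcy, fun i _ => ⟨?_, fun hbi => ?_⟩⟩
  · by_contra hneg
    obtain ⟨ε, hε, hε'⟩ := (hfr'.and_eventually
      (eventually_add_mul_pos (-(b i)) (neg_pos.2 (not_le.1 hneg)))).exists
    have := hε i
    linarith
  · by_contra hneg
    obtain ⟨ε, hε, hε'⟩ := (hfr'.and_eventually self_mem_nhdsWithin).exists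
    have := hε i
    have hε0 : 0 < ε := hε'
    nlinarith [mul_pos hε0 (neg_pos.2 hbi)]

lemma halfOpenCell_unique {q : ι → V} {e : V} (he : IsGenericDirection q e) {A B : Set ι}
    (hA : A ∈ maxCells q) (hB : B ∈ maxCells q) {y : V} (hyA : y ∈ halfOpenCell q e A)
    (hyB : y ∈ halfOpenCell q e B) : A = B := by
  obtain ⟨ε, ⟨c, hc, hc0, hcs⟩, ⟨c', hc', hc0', hcs'⟩⟩ :=
    ((eventually_of_mem_halfOpenCell he hA hyA).and
      (eventually_of_mem_halfOpenCell he hB hyB)).exists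
  have hnn : ∀ i, 0 ≤ c i := fun i => by
    by_cases hi : i ∈ A
    · exact (hc0 i hi).le
    · exact (hc i hi).ge
  have hnn' : ∀ i, 0 ≤ c' i := fun i => by
    by_cases hi : i ∈ B
    · exact (hc0' i hi).le
    · exact (hc' i hi).ge
  have heq := hA.1.unique hB.1 hc hc' (fun i _ => hnn i) (fun i _ => hnn' i) (hcs.trans hcs'.symm)
  subst heq
  ext i
  constructor
  · intro hi
    by_contra h
    exact (hc0 i hi).ne' (hc' i h)
  · intro hi
    by_contra h
    exact (hc0' i hi).ne' (hc i h)

end LexTriangulation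

/-! ### Ehrhart reciprocity for cones -/

section EhrhartCone

open Filter Topology Polynomial

variable {V ι : Type*} [NormedAddCommGroup V] [NormedSpace ℝ V] [Fintype ι]

/-- The points of a cone from which one can move a little backwards along every vector of it. -/
def genConeInterior (q : ι → V) : Set V :=
  {y | y ∈ Submodule.span ℝ (Set.range q) ∧ ∀ z ∈ genCone q, ∃ ε > (0 : ℝ), y - ε • z ∈ genCone q}

lemma halfOpenCell_subset_genCone {q : ι → V} {e : V} {A : Set ι} :
    halfOpenCell q e A ⊆ genCone q := by
  rintro y ⟨b, c, hb, hc, hbe, hcy, hcb⟩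
  refine ⟨c, fun i => ?_, hcy⟩
  by_cases hi : i ∈ A
  · exact (hcb i hi).1
  · exact (hc i hi).ge

lemma eventually_mem_genCone_iff {q : ι → V} (h : V →L[ℝ] ℝ) (hq : ∀ i, h (q i) = 1) {e : V}
    (he : IsGenericDirection q e) {y : V} :
    (∀ᶠ ε in 𝓝[>] (0 : ℝ), y + ε • e ∈ genCone q) ↔ ∃ A ∈ maxCells q, y ∈ halfOpenCell q e A := by
  constructor
  · intro hy
    refine exists_mem_halfOpenCell h hq he ?_ hy
    obtain ⟨ε, hε⟩ := hy.exists
    have := (Submodule.span ℝ (Set.range q)).sub_mem (mem_span_of_mem_genCone hε)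
      (Submodule.smul_mem _ ε he.1)
    simpa using this
  · rintro ⟨A, hA, hy⟩
    filter_upwards [eventually_of_mem_halfOpenCell he hA hy] with ε ⟨c, hc, hc0, hcs⟩
    refine ⟨c, fun i => ?_, hcs⟩
    by_cases hi : i ∈ A
    · exact (hc0 i hi).le
    · exact (hc i hi).ge

lemma eventually_add_mem_genCone_iff {q : ι → V} (h : V →L[ℝ] ℝ) (hq : ∀ i, h (q i) = 1)
    {w : ι → ℝ} (hw : ∀ i, 0 < w i) (he : IsGenericDirection q (∑ i, w i • q i)) {y : V} :
    (∀ᶠ ε in 𝓝[>] (0 : ℝ), y + ε • (∑ i, w i • q i) ∈ genCone q) ↔ y ∈ genCone q := by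
  constructor
  · intro hy
    obtain ⟨A, -, hyA⟩ := (eventually_mem_genCone_iff h hq he).1 hy
    exact halfOpenCell_subset_genCone hyA
  · intro hy
    filter_upwards [self_mem_nhdsWithin] with ε hε
    exact genCone_add_mem hy (genCone_smul_mem (le_of_lt hε) ⟨w, fun i => (hw i).le, rfl⟩)

/-- A strictly positive combination of the generators absorbs a small multiple of any vector of the
cone, so room to move backwards along it gives room along all of them. -/
lemma eventually_sub_mem_genCone_iff {q : ι → V} {w : ι → ℝ} (hw : ∀ i, 0 < w i) {y : V} :
    (∀ᶠ ε in 𝓝[>] (0 : ℝ), y + ε • (-∑ i, w i • q i) ∈ genCone q) ↔ y ∈ genConeInterior q := by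
  have hu : (∑ i, w i • q i) ∈ genCone q := ⟨w, fun i => (hw i).le, rfl⟩
  constructor
  · intro hy
    obtain ⟨ε, hε, hε0⟩ := (hy.and self_mem_nhdsWithin).exists
    have hε0 : 0 < ε := hε0
    refine ⟨?_, ?_⟩
    · have := add_mem (mem_span_of_mem_genCone hε)
        (Submodule.smul_mem _ ε (mem_span_of_mem_genCone hu))
      simpa using this
    · rintro _ ⟨c, hc, rfl⟩
      have hev : ∀ᶠ δ in 𝓝[>] (0 : ℝ), ∀ i, 0 < w i + δ * (-c i) :=
        eventually_all.2 fun i => eventually_add_mul_pos _ (hw i)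
      obtain ⟨δ, hδ, hδ0⟩ := (hev.and self_mem_nhdsWithin).exists
      have hδ0 : 0 < δ := hδ0
      refine ⟨ε * δ, mul_pos hε0 hδ0, ?_⟩
      have h1 : (∑ i, w i • q i) - δ • ∑ i, c i • q i ∈ genCone q := by
        refine ⟨fun i => w i + δ * (-c i), fun i => (hδ i).le, ?_⟩
        simp [add_smul, Finset.sum_add_distrib, mul_smul, Finset.smul_sum, sub_eq_add_neg]
      have h2 := genCone_add_mem hε (genCone_smul_mem hε0.le h1)
      convert h2 using 1
      module
  · rintro ⟨-, hy⟩
    obtain ⟨δ, hδ, hmem⟩ := hy _ hu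
    filter_upwards [Ioo_mem_nhdsGT hδ] with ε hε
    have h2 := genCone_add_mem hmem (genCone_smul_mem (sub_nonneg.2 hε.2.le) hu)
    convert h2 using 1
    module

lemma height_sum {q : ι → V} (h : V →L[ℝ] ℝ) (hq : ∀ i, h (q i) = 1) (c : ι → ℝ) :
    h (∑ i, c i • q i) = ∑ i, c i := by
  simp [hq]

lemma finite_genCone_height {q : ι → V} (h : V →L[ℝ] ℝ) (hq : ∀ i, h (q i) = 1)
    {Λ : AddSubgroup V} (hfin : ∀ R : ℝ, {x | x ∈ Λ ∧ ‖x‖ ≤ R}.Finite) (t : ℕ) :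
    {y | y ∈ Λ ∧ h y = t ∧ y ∈ genCone q}.Finite := by
  refine (hfin (∑ i, t * ‖q i‖)).subset ?_
  rintro y ⟨hy, hyt, c, hc, rfl⟩
  refine ⟨hy, (norm_sum_le _ _).trans (Finset.sum_le_sum fun i _ => ?_)⟩
  rw [height_sum h hq] at hyt
  rw [norm_smul, Real.norm_of_nonneg (hc i), ← hyt]
  exact mul_le_mul_of_nonneg_right
    (Finset.single_le_sum (fun j _ => hc j) (Finset.mem_univ i)) (norm_nonneg _)

/-- The lattice `Λ` in the coordinates given by the vectors of a cell. -/
noncomputable def cellLattice (q : ι → V) (Λ : AddSubgroup V) (A : Set ι) [Fintype A] :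
    AddSubgroup (A → ℝ) :=
  Λ.comap (Fintype.linearCombination ℝ (fun i : A => q i)).toAddMonoidHom

lemma mem_cellLattice {κ : Type*} {q : κ → V} {Λ : AddSubgroup V} {A : Set κ} [Fintype A] {x : A → ℝ} :
    x ∈ cellLattice q Λ A ↔ ∑ i, x i • q i ∈ Λ := by
  simp [cellLattice, Fintype.linearCombination_apply]

lemma card_halfOpenCell {q : ι → V} (h : V →L[ℝ] ℝ) (hq : ∀ i, h (q i) = 1)
    (Λ : AddSubgroup V) {A : Set ι} [Fintype A] (hA : A ∈ maxCells q) {e : V} {b : ι → ℝ}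
    (hb : ∀ i ∉ A, b i = 0) (hbe : ∑ i, b i • q i = e) (t : ℕ) :
    Nat.card {y // y ∈ Λ ∧ h y = t ∧ y ∈ halfOpenCell q e A} =
      Nat.card {x : A → ℝ // x ∈ cellLattice q Λ A ∧ x ∈ halfOpenOrthant {i : A | b i < 0} ∧
        ∑ i, x i = t} := by
  classical
  have hli := hA.1.linearIndependent
  rw [Fintype.linearIndependent_iff] at hli
  let ext : (A → ℝ) → ι → ℝ := fun x i => if hi : i ∈ A then x ⟨i, hi⟩ else 0
  have hext0 : ∀ x, ∀ i ∉ A, ext x i = 0 := fun x i hi => by simp [ext, hi]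
  have hextA : ∀ x, ∀ i : A, ext x i = x i := fun x i => by simp [ext]
  have hext : ∀ x, ∑ i, ext x i • q i = ∑ i, x i • q i := fun x => by
    rw [sum_eq_sum_coe (A := A) fun i hi => by rw [hext0 x i hi, zero_smul]]
    simp only [hextA]
  let f : {x : A → ℝ // x ∈ cellLattice q Λ A ∧ x ∈ halfOpenOrthant {i : A | b i < 0} ∧
      ∑ i, x i = t} → {y // y ∈ Λ ∧ h y = t ∧ y ∈ halfOpenCell q e A} := fun x =>
    ⟨∑ i, x.1 i • q i, mem_cellLattice.1 x.2.1, by simp [hq, x.2.2.2],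
      b, ext x.1, hb, hext0 _, hbe, hext _, fun i hi => by
        have := x.2.2.1 ⟨i, hi⟩
        rw [← hextA x.1 ⟨i, hi⟩] at this
        exact this⟩
  refine (Nat.card_congr (Equiv.ofBijective f ⟨fun x y hxy => ?_, ?_⟩)).symm
  · have h1 : ∑ i, x.1 i • q i = ∑ i, y.1 i • q i := congrArg Subtype.val hxy
    apply Subtype.ext
    funext i
    have := hli (x.1 - y.1) (by simp [sub_smul, Finset.sum_sub_distrib, h1]) i
    simpa [sub_eq_zero] using this
  · rintro ⟨y, hyΛ, hyt, b', c, hb', hc, hbe', hcy, hcb⟩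
    obtain rfl := hA.1.coeff_unique hb hb' (hbe.trans hbe'.symm)
    have hcA : ∑ i, c i • q i = ∑ i : A, c i • q i :=
      sum_eq_sum_coe (A := A) fun i hi => by rw [hc i hi, zero_smul]
    refine ⟨⟨fun i => c i, mem_cellLattice.2 ?_, fun i => hcb i i.2, ?_⟩, Subtype.ext ?_⟩
    · rwa [← hcA, hcy]
    · rw [← sum_eq_sum_coe hc, ← hyt, ← hcy, height_sum h hq]
    · simp only [f]
      rw [← hcA, hcy]

lemma card_eq_sum_card_halfOpenCell {q : ι → V} (h : V →L[ℝ] ℝ) (hq : ∀ i, h (q i) = 1)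
    {Λ : AddSubgroup V} (hfin : ∀ R : ℝ, {x | x ∈ Λ ∧ ‖x‖ ≤ R}.Finite) {e : V}
    (he : IsGenericDirection q e) [Fintype (maxCells q)] (t : ℕ) :
    Nat.card {y // y ∈ Λ ∧ h y = t ∧ ∀ᶠ ε in 𝓝[>] (0 : ℝ), y + ε • e ∈ genCone q} =
      ∑ A : maxCells q, Nat.card {y // y ∈ Λ ∧ h y = t ∧ y ∈ halfOpenCell q e A} := by
  have hf : ∀ A : maxCells q, Finite {y // y ∈ Λ ∧ h y = t ∧ y ∈ halfOpenCell q e A} := fun A =>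
    Set.Finite.to_subtype ((finite_genCone_height h hq hfin t).subset
      fun y hy => ⟨hy.1, hy.2.1, halfOpenCell_subset_genCone hy.2.2⟩)
  rw [← Nat.card_sigma]
  let f : (Σ A : maxCells q, {y // y ∈ Λ ∧ h y = t ∧ y ∈ halfOpenCell q e A}) →
      {y // y ∈ Λ ∧ h y = t ∧ ∀ᶠ ε in 𝓝[>] (0 : ℝ), y + ε • e ∈ genCone q} := fun z =>
    ⟨z.2.1, z.2.2.1, z.2.2.2.1,
      (eventually_mem_genCone_iff h hq he).2 ⟨z.1, z.1.2, z.2.2.2.2⟩⟩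
  refine (Nat.card_congr (Equiv.ofBijective f ⟨?_, ?_⟩)).symm
  · rintro ⟨A, y, hy⟩ ⟨B, z, hz⟩ hyz
    obtain rfl : y = z := congrArg Subtype.val hyz
    obtain rfl : A = B := Subtype.ext (halfOpenCell_unique he A.2 B.2 hy.2.2 hz.2.2)
    rfl
  · rintro ⟨y, hyΛ, hyt, hy⟩
    obtain ⟨A, hA, hyA⟩ := (eventually_mem_genCone_iff h hq he).1 hy
    exact ⟨⟨⟨A, hA⟩, y, hyΛ, hyt, hyA⟩, rfl⟩

/-- Ehrhart's theorem with reciprocity for the cone over a lattice polytope. -/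
theorem exists_ehrhart_genCone {q : ι → V} (h : V →L[ℝ] ℝ) (hq : ∀ i, h (q i) = 1)
    {Λ : AddSubgroup V} (hqΛ : ∀ i, q i ∈ Λ) (hΛ : ∀ x ∈ Λ, ∃ k : ℤ, h x = k)
    (hfin : ∀ R : ℝ, {x | x ∈ Λ ∧ ‖x‖ ≤ R}.Finite) {p : ℕ}
    (hp : Module.finrank ℝ (Submodule.span ℝ (Set.range q)) = p + 1) :
    ∃ f : ℝ[X], f.natDegree ≤ p ∧ ∀ t : ℕ, 1 ≤ t →
      f.eval (t : ℝ) = Nat.card {y // y ∈ Λ ∧ h y = t ∧ y ∈ genCone q} ∧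
      (-1) ^ p * f.eval (-(t : ℝ)) =
        Nat.card {y // y ∈ Λ ∧ h y = t ∧ y ∈ genConeInterior q} := by
  classical
  obtain ⟨w, hw, he⟩ := exists_generic_interior q
  set e := ∑ i, w i • q i with hedef
  have := Fintype.ofFinite (maxCells q)
  have hcell : ∀ A : maxCells q, ∃ f : ℝ[X], f.natDegree ≤ p ∧ ∀ t : ℕ, 1 ≤ t →
      f.eval (t : ℝ) = Nat.card {y // y ∈ Λ ∧ h y = t ∧ y ∈ halfOpenCell q e A} ∧
      (-1) ^ p * f.eval (-(t : ℝ)) =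
        Nat.card {y // y ∈ Λ ∧ h y = t ∧ y ∈ halfOpenCell q (-e) A} := by
    rintro ⟨A, hA⟩
    obtain ⟨b, hb, hbe⟩ := exists_sum_smul_of_mem_span
      (show e ∈ Submodule.span ℝ (q '' A) from hA.2 ▸ he.1)
    have hli := hA.1.linearIndependent
    have hcard : Fintype.card A = p + 1 := by
      rw [← hp, ← hA.2, Set.image_eq_range]
      exact (finrank_span_eq_card hli).symm
    obtain ⟨f, hf, hft⟩ := exists_ehrhart_halfOpenOrthant hcard (cellLattice q Λ A)
      (fun i => mem_cellLattice.2 (by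
        rw [Finset.sum_eq_single i] <;> simp +contextual [hqΛ]))
      (fun x hx => by
        obtain ⟨k, hk⟩ := hΛ _ (mem_cellLattice.1 hx)
        exact ⟨k, by rw [← hk]; simp [hq]⟩)
      (by
        refine Set.Finite.of_finite_image (f := fun x : A → ℝ => ∑ i, x i • q i)
          ((hfin (∑ i : A, ‖q i‖)).subset ?_) ?_
        · rintro _ ⟨x, ⟨hx, hx1⟩, rfl⟩
          refine ⟨mem_cellLattice.1 hx, (norm_sum_le _ _).trans (Finset.sum_le_sum fun i _ => ?_)⟩
          rw [norm_smul, Real.norm_of_nonneg (hx1 i).1]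
          exact mul_le_of_le_one_left (norm_nonneg _) (hx1 i).2
        · intro x _ y _ hxy
          exact hli.fintypeLinearCombination_injective (by
            simpa [Fintype.linearCombination_apply] using hxy))
      {i : A | b i < 0}
    refine ⟨f, hf, fun t ht => ⟨?_, ?_⟩⟩
    · rw [(hft t ht).1, card_halfOpenCell h hq Λ hA hb hbe]
    -- Complementing the removed facets is the same as reversing `e`, because genericity excludes `b
    -- i = 0`.
    · have hO : {i : A | b i < 0}ᶜ = {i : A | (-b) i < 0} := by
        ext i
        have := he.coeff_ne_zero hA hb hbe i.2
        simp only [Set.mem_compl_iff, Set.mem_ofPred_eq, not_lt, Pi.neg_apply, neg_lt_zero]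
        exact ⟨fun h => lt_of_le_of_ne h this.symm, le_of_lt⟩
      rw [(hft t ht).2, hO, card_halfOpenCell (b := -b) h hq Λ hA
        (fun i hi => by simp [hb i hi]) (by simp [hbe])]
  choose f hf hft using hcell
  refine ⟨∑ A, f A, natDegree_sum_le_of_forall_le _ _ fun A _ => hf A, fun t ht => ⟨?_, ?_⟩⟩
  · have := card_eq_sum_card_halfOpenCell h hq hfin he t
    simp only [hedef, eventually_add_mem_genCone_iff h hq hw he] at this
    rw [this, eval_finsetSum, Nat.cast_sum]
    exact Finset.sum_congr rfl fun A _ => (hft A t ht).1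
  · have := card_eq_sum_card_halfOpenCell h hq hfin he.neg t
    simp only [hedef, eventually_sub_mem_genCone_iff hw] at this
    rw [this, eval_finsetSum, Finset.mul_sum, Nat.cast_sum]
    exact Finset.sum_congr rfl fun A _ => (hft A t ht).2

end EhrhartCone

/-! ### Relative interiors of convex sets -/

section RelativeInterior

variable {E : Type*} [NormedAddCommGroup E] [NormedSpace ℝ E]

lemma zero_mem_interior_of_mem_intrinsicInterior {G : Set E} {x z : E} (hx : x ∈ G)
    (hz : z ∈ intrinsicInterior ℝ G) :
    ∃ w : vectorSpan ℝ G, x + w = z ∧ w ∈ interior {w : vectorSpan ℝ G | x + (w : E) ∈ G} := by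
  obtain ⟨y, hy, rfl⟩ := hz
  have hxa : x ∈ affineSpan ℝ G := subset_affineSpan ℝ G hx
  let φ : vectorSpan ℝ G → affineSpan ℝ G := fun w => ⟨x + w, by
    rw [add_comm]
    exact AffineSubspace.vadd_mem_of_mem_direction
      (by rw [direction_affineSpan]; exact w.2) hxa⟩
  have hφ : Continuous φ := by fun_prop
  have hyx : (y : E) - x ∈ vectorSpan ℝ G := by
    rw [← direction_affineSpan]
    exact AffineSubspace.vsub_mem_direction y.2 hxa
  have hφy : φ ⟨(y : E) - x, hyx⟩ = y := Subtype.ext (by simp [φ])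
  refine ⟨⟨(y : E) - x, hyx⟩, by simp, ?_⟩
  refine preimage_interior_subset_interior_preimage (t := ((↑) ⁻¹' G : Set (affineSpan ℝ G))) hφ ?_
  rw [Set.mem_preimage, hφy]
  exact hy

lemma mem_intrinsicInterior_of_zero_mem_interior {G : Set E} {x : E} (hx : x ∈ G)
    (h0 : (0 : vectorSpan ℝ G) ∈ interior {w : vectorSpan ℝ G | x + (w : E) ∈ G}) :
    x ∈ intrinsicInterior ℝ G := by
  have hxa : x ∈ affineSpan ℝ G := subset_affineSpan ℝ G hx
  let ψ : affineSpan ℝ G → vectorSpan ℝ G := fun a => ⟨(a : E) - x, by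
    rw [← direction_affineSpan]
    exact AffineSubspace.vsub_mem_direction a.2 hxa⟩
  have hψ : Continuous ψ := by fun_prop
  refine ⟨⟨x, hxa⟩, ?_, rfl⟩
  have h1 := preimage_interior_subset_interior_preimage hψ (a := ⟨x, hxa⟩) (by
    have : ψ ⟨x, hxa⟩ = 0 := Subtype.ext (by simp [ψ])
    rw [Set.mem_preimage, this]
    exact h0)
  convert h1 using 2
  ext a
  simp [ψ]

variable [FiniteDimensional ℝ E]

/-- A point of a convex set outside its relative interior lies on a supporting hyperplane that
does not contain the set. -/
lemma exists_support_of_notMem_intrinsicInterior {G : Set E} (hG : Convex ℝ G) {x : E} (hx : x ∈ G)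
    (hxi : x ∉ intrinsicInterior ℝ G) :
    ∃ l : E →L[ℝ] ℝ, (∀ y ∈ G, l y ≤ l x) ∧ ∃ y ∈ G, l y < l x := by
  set G' : Set (vectorSpan ℝ G) := {w | x + (w : E) ∈ G} with hG'
  have hconv : Convex ℝ G' := by
    intro a ha b hb s t hs ht hst
    have : x + ((s • a + t • b : vectorSpan ℝ G) : E) = s • (x + (a : E)) + t • (x + (b : E)) := by
      have h1 : x = (s + t) • x := by rw [hst, one_smul]
      push_cast
      nth_rewrite 1 [h1]
      module
    rw [hG', Set.mem_ofPred_eq, this]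
    exact hG ha hb hs ht hst
  have h0 : (0 : vectorSpan ℝ G) ∉ interior G' := fun h =>
    hxi (mem_intrinsicInterior_of_zero_mem_interior hx h)
  obtain ⟨z, hz⟩ := (Set.Nonempty.intrinsicInterior hG ⟨x, hx⟩)
  obtain ⟨w, hwz, hw⟩ := zero_mem_interior_of_mem_intrinsicInterior hx hz
  obtain ⟨f, hf⟩ := geometric_hahn_banach_open_point hconv.interior isOpen_interior h0
  obtain ⟨g, hg, -⟩ := exists_extension_norm_eq _ f
  -- Separation is strict on the interior only; density of the interior in `G'` extends the weak
  -- inequality. Strictness survives at the relative interior point `z`.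
  have hle : ∀ v ∈ G', f v ≤ 0 := by
    have hsub : closure (interior G') ⊆ {v | f v ≤ 0} :=
      closure_minimal (fun v hv => by simpa using (hf v hv).le)
        (isClosed_le f.continuous continuous_const)
    intro v hv
    refine hsub ?_
    rw [hconv.closure_interior_eq_closure_of_nonempty_interior ⟨w, hw⟩]
    exact subset_closure hv
  refine ⟨g, fun y hy => ?_, z, intrinsicInterior_subset hz, ?_⟩
  · have h1 := hle ⟨y - x, vsub_mem_vectorSpan ℝ hy hx⟩ (by simpa [hG'] using hy)
    rw [← hg] at h1
    simp only [map_sub] at h1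
    linarith
  · have h1 := hf w hw
    rw [← hg, map_zero] at h1
    rw [← hwz, map_add]
    linarith

/-- An algebraic criterion free of topology: a supporting hyperplane at a point outside the relative
interior forbids going beyond `x` away from some `y`. It has the same shape as `genConeInterior`,
which makes the two comparable. -/
lemma mem_intrinsicInterior_iff {G : Set E} (hG : Convex ℝ G) {x : E} :
    x ∈ intrinsicInterior ℝ G ↔ x ∈ G ∧ ∀ y ∈ G, ∃ ε > (0 : ℝ), x + ε • (x - y) ∈ G := by
  constructor
  · intro hx
    have hxG := intrinsicInterior_subset hx
    refine ⟨hxG, fun y hy => ?_⟩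
    obtain ⟨w, hw, hw'⟩ := zero_mem_interior_of_mem_intrinsicInterior hxG hx
    have hw0 : w = 0 := Subtype.ext (by simpa using hw)
    rw [hw0] at hw'
    let v : vectorSpan ℝ G := ⟨x - y, vsub_mem_vectorSpan ℝ hxG hy⟩
    have hc : Continuous fun ε : ℝ => ε • v := by fun_prop
    have h1 := hc.tendsto 0
    rw [zero_smul] at h1
    have h2 := (h1.eventually (mem_interior_iff_mem_nhds.1 hw')).filter_mono
      (nhdsWithin_le_nhds (s := Set.Ioi 0))
    obtain ⟨ε, hε, hε0⟩ := (h2.and self_mem_nhdsWithin).exists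
    exact ⟨ε, hε0, hε⟩
  · rintro ⟨hxG, h⟩
    by_contra hx
    obtain ⟨l, hl, y, hy, hly⟩ := exists_support_of_notMem_intrinsicInterior hG hxG hx
    obtain ⟨ε, hε, hmem⟩ := h y hy
    have := hl _ hmem
    simp only [map_add, map_smul, map_sub, smul_eq_mul] at this
    nlinarith [mul_pos hε (sub_pos.2 hly)]

lemma smul_mem_intrinsicInterior_smul_iff {G : Set E} (hG : Convex ℝ G) {r : ℝ} (hr : 0 < r)
    {x : E} : r • x ∈ intrinsicInterior ℝ (r • G) ↔ x ∈ intrinsicInterior ℝ G := by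
  rw [mem_intrinsicInterior_iff hG, mem_intrinsicInterior_iff (hG.smul r),
    Set.smul_mem_smul_set_iff₀ hr.ne']
  refine and_congr_right fun _ => ⟨fun h y hy => ?_, ?_⟩
  · obtain ⟨ε, hε, hmem⟩ := h (r • y) (Set.smul_mem_smul_set hy)
    refine ⟨ε, hε, ?_⟩
    rwa [← smul_sub, smul_comm, ← smul_add, Set.smul_mem_smul_set_iff₀ hr.ne'] at hmem
  · rintro h _ ⟨y, hy, rfl⟩
    obtain ⟨ε, hε, hmem⟩ := h y hy
    refine ⟨ε, hε, ?_⟩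
    show r • x + ε • (r • x - r • y) ∈ r • G
    rwa [← smul_sub, smul_comm, ← smul_add, Set.smul_mem_smul_set_iff₀ hr.ne']

end RelativeInterior

/-! ### Ehrhart reciprocity for lattice polytopes -/

section EhrhartPolytope

open Polynomial

lemma finite_intLattice_norm_le (d : ℕ) (R : ℝ) :
    {x : Fin d → ℝ | x ∈ intLattice d ∧ ‖x‖ ≤ R}.Finite := by
  refine ((Set.finite_Icc (fun _ : Fin d => ⌊-R⌋) (fun _ => ⌈R⌉)).image
    (fun (k : Fin d → ℤ) j => (k j : ℝ))).subset ?_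
  rintro x ⟨hx, hxR⟩
  choose k hk using hx
  refine ⟨k, ⟨fun j => ?_, fun j => ?_⟩, funext hk⟩
  · have h1 := (norm_le_pi_norm x j).trans hxR
    rw [← hk, Real.norm_eq_abs] at h1
    have h2 : -R ≤ (k j : ℝ) := by linarith [(abs_le.1 h1).1]
    have : (⌊-R⌋ : ℝ) ≤ k j := (Int.floor_le _).trans h2
    exact_mod_cast this
  · have h1 := (norm_le_pi_norm x j).trans hxR
    rw [← hk, Real.norm_eq_abs] at h1
    have : (k j : ℝ) ≤ ⌈R⌉ := (abs_le.1 h1).2.trans (Int.le_ceil _)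
    exact_mod_cast this

/-- The lattice `ℤ^d × ℤ` in which the cone over a lattice polytope lives. -/
def homLattice (d : ℕ) : AddSubgroup ((Fin d → ℝ) × ℝ) :=
  (intLattice d).toAddSubgroup.prod (Int.castAddHom ℝ).range

lemma mem_homLattice {d : ℕ} {y : (Fin d → ℝ) × ℝ} :
    y ∈ homLattice d ↔ y.1 ∈ intLattice d ∧ ∃ k : ℤ, (k : ℝ) = y.2 := by
  exact Iff.rfl

lemma finite_homLattice_norm_le (d : ℕ) (R : ℝ) : {y | y ∈ homLattice d ∧ ‖y‖ ≤ R}.Finite := by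
  refine ((finite_intLattice_norm_le d R).prod
    ((Set.finite_Icc ⌊-R⌋ ⌈R⌉).image (fun k : ℤ => (k : ℝ)))).subset ?_
  rintro y ⟨hy, hyR⟩
  obtain ⟨h1, k, hk⟩ := mem_homLattice.1 hy
  refine ⟨⟨h1, (norm_fst_le y).trans hyR⟩, k, ⟨?_, ?_⟩, hk⟩
  · have h1 := (norm_snd_le y).trans hyR
    rw [← hk, Real.norm_eq_abs] at h1
    have h2 : -R ≤ (k : ℝ) := by linarith [(abs_le.1 h1).1]
    have : (⌊-R⌋ : ℝ) ≤ k := (Int.floor_le _).trans h2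
    exact_mod_cast this
  · have h1 := (norm_snd_le y).trans hyR
    rw [← hk, Real.norm_eq_abs] at h1
    have : (k : ℝ) ≤ ⌈R⌉ := (abs_le.1 h1).2.trans (Int.le_ceil _)
    exact_mod_cast this

variable {E : Type*} [NormedAddCommGroup E] [NormedSpace ℝ E]

/-- The generators of the cone over the convex hull of a finite set. -/
def homPoint (S : Finset E) : S → E × ℝ := fun s => ((s : E), 1)

lemma mem_genCone_homPoint_iff {S : Finset E} {r : ℝ} (hr : 0 < r) {x : E} :
    (x, r) ∈ genCone (homPoint S) ↔ x ∈ r • convexHull ℝ (S : Set E) := by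
  rw [Set.mem_smul_set_iff_inv_smul_mem₀ hr.ne', Finset.mem_convexHull']
  constructor
  · rintro ⟨c, hc, hcx⟩
    classical
    have h1 : ∑ i, c i • (i : E) = x := by
      have := congrArg Prod.fst hcx
      simpa [homPoint, Prod.fst_sum] using this
    have h2 : ∑ i, c i = r := by
      have := congrArg Prod.snd hcx
      simpa [homPoint, Prod.snd_sum] using this
    refine ⟨fun y => if hy : y ∈ S then r⁻¹ * c ⟨y, hy⟩ else 0, fun y hy => ?_, ?_, ?_⟩
    · simp only [hy, dif_pos]
      exact mul_nonneg (inv_nonneg.2 hr.le) (hc _)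
    · rw [← Finset.sum_coe_sort]
      simp only [Subtype.coe_eta, Finset.coe_mem, dif_pos]
      rw [← Finset.mul_sum, h2, inv_mul_cancel₀ hr.ne']
    · rw [← Finset.sum_coe_sort]
      simp only [Subtype.coe_eta, Finset.coe_mem, dif_pos, mul_smul]
      rw [← Finset.smul_sum, h1]
  · rintro ⟨w, hw, hw1, hwx⟩
    refine ⟨fun i => r * w i, fun i => mul_nonneg hr.le (hw i i.2), ?_⟩
    apply Prod.ext
    · rw [Prod.fst_sum]
      simp only [homPoint, Prod.smul_mk, mul_smul, ← Finset.smul_sum]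
      rw [Finset.sum_coe_sort S (fun y => w y • y), hwx, smul_inv_smul₀ hr.ne']
    · rw [Prod.snd_sum]
      simp only [homPoint, Prod.smul_mk, smul_eq_mul, mul_one, ← Finset.mul_sum]
      rw [Finset.sum_coe_sort S (fun y => w y), hw1, mul_one]

lemma eq_zero_of_mem_genCone_homPoint {S : Finset E} {z : E × ℝ}
    (hz : z ∈ genCone (homPoint S)) : 0 ≤ z.2 ∧ (z.2 = 0 → z = 0) := by
  obtain ⟨c, hc, rfl⟩ := hz
  have h2 : (∑ i, c i • homPoint S i).2 = ∑ i, c i := by simp [homPoint, Prod.snd_sum]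
  rw [h2]
  refine ⟨Finset.sum_nonneg fun i _ => hc i, fun h => ?_⟩
  rw [Finset.sum_eq_zero_iff_of_nonneg fun i _ => hc i] at h
  exact Finset.sum_eq_zero fun i hi => by rw [h i hi, zero_smul]

lemma mem_genConeInterior_homPoint_iff [FiniteDimensional ℝ E] {S : Finset E} {r : ℝ} (hr : 0 < r)
    {x : E} : (x, r) ∈ genConeInterior (homPoint S) ↔
      x ∈ intrinsicInterior ℝ (r • convexHull ℝ (S : Set E)) := by
  rw [mem_intrinsicInterior_iff ((convex_convexHull ℝ _).smul r)]
  constructor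
  · rintro ⟨-, h⟩
    have h0 : (0 : E × ℝ) ∈ genCone (homPoint S) := ⟨0, fun _ => le_rfl, by simp⟩
    have hx : (x, r) ∈ genCone (homPoint S) := by
      obtain ⟨ε, -, hε⟩ := h 0 h0
      simpa using hε
    refine ⟨(mem_genCone_homPoint_iff hr).1 hx, fun y hy => ?_⟩
    have hy' := (mem_genCone_homPoint_iff hr).2 hy
    obtain ⟨ε, hε, hmem⟩ := h _ hy'
    -- Subtracting `δ • (y, r)` lowers the height to `(1 - δ) * r`. Dividing by `1 - δ > 0` returns
    -- to height `r` and yields `x + (δ / (1 - δ)) • (x - y)`.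
    obtain ⟨δ, hδ0, hδε, hδ1⟩ : ∃ δ : ℝ, 0 < δ ∧ δ ≤ ε ∧ δ < 1 :=
      ⟨min ε (1 / 2), by positivity, min_le_left _ _,
        (min_le_right _ _).trans_lt (by norm_num)⟩
    have hmem' := genCone_add_mem hmem (genCone_smul_mem (sub_nonneg.2 hδε) hy')
    have hd : 0 < 1 - δ := by linarith
    have h3 := genCone_smul_mem (inv_nonneg.2 hd.le) hmem'
    refine ⟨δ / (1 - δ), by positivity, (mem_genCone_homPoint_iff hr).1 ?_⟩
    convert h3 using 1
    apply Prod.ext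
    · simp only [Prod.smul_mk, Prod.mk_sub_mk, Prod.mk_add_mk]
      rw [← sub_eq_zero]
      have : (1 - δ)⁻¹ = 1 + δ / (1 - δ) := by field_simp; ring
      rw [this, div_eq_mul_inv, this]
      match_scalars <;> field_simp <;> ring
    · simp only [Prod.smul_mk, Prod.mk_sub_mk, Prod.mk_add_mk, smul_eq_mul]
      field_simp
      ring
  · rintro ⟨hx, h⟩
    have hx' := (mem_genCone_homPoint_iff hr).2 hx
    refine ⟨mem_span_of_mem_genCone hx', fun z hz => ?_⟩
    obtain ⟨hz0, hz00⟩ := eq_zero_of_mem_genCone_homPoint hz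
    rcases hz0.lt_or_eq with hpos | h0
    · obtain ⟨y, ρ⟩ := z
      have hρ : 0 < ρ := hpos
      have hy : (r / ρ) • y ∈ r • convexHull ℝ (S : Set E) := by
        refine (mem_genCone_homPoint_iff hr).1 ?_
        have := genCone_smul_mem (div_nonneg hr.le hρ.le) hz
        rwa [Prod.smul_mk, smul_eq_mul, div_mul_cancel₀ _ hρ.ne'] at this
      obtain ⟨ε, hε, hmem⟩ := h _ hy
      have h1ε : 0 < 1 + ε := by linarith
      have h3 := genCone_smul_mem (inv_nonneg.2 h1ε.le) ((mem_genCone_homPoint_iff hr).2 hmem)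
      refine ⟨ε / (1 + ε) * (r / ρ), by positivity, ?_⟩
      convert h3 using 1
      apply Prod.ext
      · simp only [Prod.smul_mk, Prod.mk_sub_mk]
        match_scalars <;> field_simp
      · simp only [Prod.smul_mk, Prod.mk_sub_mk, smul_eq_mul]
        field_simp
        ring
    · exact ⟨1, one_pos, by rwa [hz00 h0.symm, smul_zero, sub_zero]⟩

/-- The shear taking `(s₀, 1)` to `(0, 1)` splits the span as the direction space times a line. -/
lemma finrank_span_homPoint [FiniteDimensional ℝ E] {S : Finset E} (hS : S.Nonempty) :
    Module.finrank ℝ (Submodule.span ℝ (Set.range (homPoint S))) =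
      Module.finrank ℝ (vectorSpan ℝ (convexHull ℝ (S : Set E))) + 1 := by
  obtain ⟨s₀, hs₀⟩ := hS
  let φ : (E × ℝ) ≃ₗ[ℝ] (E × ℝ) :=
    { toFun := fun y => (y.1 - y.2 • s₀, y.2)
      invFun := fun y => (y.1 + y.2 • s₀, y.2)
      map_add' := fun y z => Prod.ext (by simp only [Prod.fst_add, Prod.snd_add]; module) rfl
      map_smul' := fun c y => Prod.ext (by
        simp only [Prod.smul_fst, Prod.smul_snd, smul_eq_mul, RingHom.id_apply]; module) rfl
      left_inv := fun y => by simp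
      right_inv := fun y => by simp }
  have hφ : ∀ y, φ y = (y.1 - y.2 • s₀, y.2) := fun _ => rfl
  have hmap : (Submodule.span ℝ (Set.range (homPoint S))).map (φ : (E × ℝ) →ₗ[ℝ] (E × ℝ)) =
      (vectorSpan ℝ (S : Set E)).prod ⊤ := by
    apply le_antisymm
    · rw [Submodule.map_span, Submodule.span_le]
      rintro _ ⟨_, ⟨s, rfl⟩, rfl⟩
      refine ⟨?_, trivial⟩
      simpa [hφ, homPoint] using vsub_mem_vectorSpan ℝ s.2 hs₀
    · have h01 : ((0 : E), (1 : ℝ)) ∈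
          (Submodule.span ℝ (Set.range (homPoint S))).map (φ : (E × ℝ) →ₗ[ℝ] (E × ℝ)) :=
        ⟨homPoint S ⟨s₀, hs₀⟩, Submodule.subset_span ⟨_, rfl⟩, by simp [hφ, homPoint]⟩
      have hle : (vectorSpan ℝ (S : Set E)) ≤
          ((Submodule.span ℝ (Set.range (homPoint S))).map
            (φ : (E × ℝ) →ₗ[ℝ] (E × ℝ))).comap (LinearMap.inl ℝ E ℝ) := by
        rw [vectorSpan_eq_span_vsub_set_right ℝ (show s₀ ∈ (S : Set E) from hs₀),
          Submodule.span_le]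
        rintro _ ⟨s, hs, rfl⟩
        have h1 : (s - s₀, (1 : ℝ)) ∈
          (Submodule.span ℝ (Set.range (homPoint S))).map (φ : (E × ℝ) →ₗ[ℝ] (E × ℝ)) :=
          ⟨homPoint S ⟨s, hs⟩, Submodule.subset_span ⟨_, rfl⟩, by simp [hφ, homPoint]⟩
        have := sub_mem h1 h01
        rwa [Prod.mk_sub_mk, sub_zero, sub_self] at this
      rintro ⟨y, r⟩ ⟨hy, -⟩
      have h1 := add_mem (show ((y, (0 : ℝ)) : E × ℝ) ∈ _ from hle hy) (Submodule.smul_mem _ r h01)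
      simpa using h1
  have h1 := LinearEquiv.finrank_map_eq φ (Submodule.span ℝ (Set.range (homPoint S)))
  let ψ : ((vectorSpan ℝ (S : Set E)).prod (⊤ : Submodule ℝ ℝ)) ≃ₗ[ℝ]
      (vectorSpan ℝ (S : Set E)) × ℝ :=
    { toFun := fun y => (⟨y.1.1, y.2.1⟩, y.1.2)
      invFun := fun y => ⟨(y.1, y.2), y.1.2, trivial⟩
      map_add' := fun _ _ => rfl
      map_smul' := fun _ _ => rfl
      left_inv := fun _ => rfl
      right_inv := fun _ => rfl }
  rw [← direction_affineSpan, affineSpan_convexHull, direction_affineSpan, ← h1]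
  refine (congrArg (fun W : Submodule ℝ (E × ℝ) => Module.finrank ℝ W) hmap).trans ?_
  rw [ψ.finrank_eq, Module.finrank_prod, Module.finrank_self]

/-- Ehrhart's theorem with reciprocity. -/
theorem exists_ehrhart {d p : ℕ} {S : Finset (Fin d → ℝ)} (hne : S.Nonempty)
    (hS : ∀ s ∈ S, s ∈ intLattice d) (hp : polyDim (convexHull ℝ (S : Set (Fin d → ℝ))) = p) :
    ∃ f : ℝ[X], f.natDegree ≤ p ∧ ∀ t : ℕ, 1 ≤ t →
      f.eval (t : ℝ) =
        {x | x ∈ intLattice d ∧ x ∈ (t : ℝ) • convexHull ℝ (S : Set (Fin d → ℝ))}.ncard ∧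
      (-1) ^ p * f.eval (-(t : ℝ)) = {x | x ∈ intLattice d ∧
        x ∈ intrinsicInterior ℝ ((t : ℝ) • convexHull ℝ (S : Set (Fin d → ℝ)))}.ncard := by
  have hcount : ∀ (Q : Set ((Fin d → ℝ) × ℝ)) (R : Set (Fin d → ℝ)) (t : ℕ),
      (∀ x, (x, (t : ℝ)) ∈ Q ↔ x ∈ R) →
      Nat.card {y // y ∈ homLattice d ∧ ContinuousLinearMap.snd ℝ (Fin d → ℝ) ℝ y = t ∧ y ∈ Q} =
        {x | x ∈ intLattice d ∧ x ∈ R}.ncard := by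
    intro Q R t h
    refine Nat.card_congr
      { toFun := fun y => ⟨y.1.1, (mem_homLattice.1 y.2.1).1, (h _).1 ?_⟩
        invFun := fun x => ⟨(x.1, t), mem_homLattice.2 ⟨x.2.1, t, by simp⟩, rfl, (h _).2 x.2.2⟩
        left_inv := fun y => Subtype.ext (Prod.ext rfl y.2.2.1.symm)
        right_inv := fun x => rfl }
    have := y.2.2.2
    rwa [show y.1 = (y.1.1, (t : ℝ)) from Prod.ext rfl y.2.2.1] at this
  obtain ⟨f, hf, hft⟩ := exists_ehrhart_genCone (q := homPoint S) (Λ := homLattice d) (p := p)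
    (ContinuousLinearMap.snd ℝ (Fin d → ℝ) ℝ) (fun i => rfl)
    (fun i => mem_homLattice.2 ⟨hS _ i.2, 1, by simp [homPoint]⟩)
    (fun x hx => by
      obtain ⟨k, hk⟩ := (mem_homLattice.1 hx).2
      exact ⟨k, hk.symm⟩)
    (finite_homLattice_norm_le d) (by rw [finrank_span_homPoint hne, ← hp, polyDim])
  refine ⟨f, hf, fun t ht => ?_⟩
  have ht0 : (0 : ℝ) < t := by exact_mod_cast ht
  rw [(hft t ht).1, (hft t ht).2, hcount _ _ t fun x => mem_genCone_homPoint_iff ht0,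
    hcount _ _ t fun x => mem_genConeInterior_homPoint_iff ht0]
  exact ⟨rfl, rfl⟩

end EhrhartPolytope

/-! ### Faces of polytopes -/

section FacesOfPolytopes

variable {E : Type*} [NormedAddCommGroup E] [NormedSpace ℝ E]

lemma le_of_mem_convexHull {S : Set E} {l : E →L[ℝ] ℝ} {c : ℝ} (h : ∀ s ∈ S, l s ≤ c) {x : E}
    (hx : x ∈ convexHull ℝ S) : l x ≤ c :=
  convexHull_min (s := S) (t := {y | l y ≤ c}) h
    (convex_halfSpace_le l.toLinearMap.isLinear c) hx

/-- Complementary slackness: a convex combination attaining the bound has weight zero on generators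
that do not attain it. -/
lemma mem_convexHull_filter_of_eq {S : Finset E} {l : E →L[ℝ] ℝ} {c : ℝ} (h : ∀ s ∈ S, l s ≤ c)
    {x : E} (hx : x ∈ convexHull ℝ (S : Set E)) (hlx : l x = c) (p : E → Prop) [DecidablePred p]
    (hp : ∀ s ∈ S, l s = c → p s) : x ∈ convexHull ℝ ((S.filter p : Finset E) : Set E) := by
  rw [Finset.mem_convexHull'] at hx ⊢
  obtain ⟨w, hw0, hw1, hwx⟩ := hx
  have hz : ∑ s ∈ S, w s * (c - l s) = 0 := by
    simp only [mul_sub, Finset.sum_sub_distrib, ← Finset.sum_mul, hw1, one_mul]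
    rw [← hlx, ← hwx, map_sum]
    simp
  rw [Finset.sum_eq_zero_iff_of_nonneg fun s hs =>
    mul_nonneg (hw0 s hs) (sub_nonneg.2 (h s hs))] at hz
  have hne : ∀ s ∈ S, w s ≠ 0 → p s := fun s hs hws =>
    hp s hs (by have := (mul_eq_zero.1 (hz s hs)).resolve_left hws; linarith)
  refine ⟨w, fun s hs => hw0 s (Finset.mem_filter.1 hs).1, ?_, ?_⟩
  · rw [Finset.sum_filter_of_ne hne, hw1]
  · rw [Finset.sum_filter_of_ne fun s hs h0 => hne s hs (left_ne_zero_of_smul h0), hwx]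

open Classical in
lemma IsExposed.eq_convexHull_filter {S : Finset E} {F : Set E}
    (hF : IsExposed ℝ (convexHull ℝ (S : Set E)) F) :
    F = convexHull ℝ ((S.filter (· ∈ F) : Finset E) : Set E) := by
  apply Set.Subset.antisymm
  · intro x hx
    obtain ⟨l, hl⟩ := hF ⟨x, hx⟩
    have hx' := hx
    rw [hl] at hx'
    have hmax : ∀ s ∈ S, l s ≤ l x := fun s hs => hx'.2 s (subset_convexHull ℝ _ hs)
    refine mem_convexHull_filter_of_eq hmax hx'.1 rfl _ fun s hs hsx => ?_
    rw [hl]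
    exact ⟨subset_convexHull ℝ _ hs, fun y hy => (hx'.2 y hy).trans hsx.ge⟩
  · refine convexHull_min (fun s hs => ?_) (hF.convex (convex_convexHull ℝ _))
    exact (Finset.mem_filter.1 hs).2

lemma finite_exposed (S : Finset E) :
    {F | F.Nonempty ∧ IsExposed ℝ (convexHull ℝ (S : Set E)) F}.Finite := by
  classical
  refine (S.powerset.finite_toSet.image fun T : Finset E => convexHull ℝ (T : Set E)).subset ?_
  rintro F ⟨-, hF⟩
  exact ⟨S.filter (· ∈ F), Finset.mem_coe.2 (Finset.mem_powerset.2 (Finset.filter_subset _ _)), hF.eq_convexHull_filter.symm⟩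

/-- A face of a face of a polytope is a face of the polytope. -/
lemma IsExposed.trans_of_polytope {S : Finset E} {F G : Set E}
    (hF : IsExposed ℝ (convexHull ℝ (S : Set E)) F) (hG : IsExposed ℝ F G) :
    IsExposed ℝ (convexHull ℝ (S : Set E)) G := by
  classical
  rintro ⟨g, hg⟩
  obtain ⟨l, hl⟩ := hF ⟨g, hG.subset hg⟩
  obtain ⟨l', hl'⟩ := hG ⟨g, hg⟩
  have hgF := hG.subset hg
  have hg1 : ∀ y ∈ convexHull ℝ (S : Set E), l y ≤ l g := by
    rw [hl] at hgF; exact hgF.2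
  have hg2 : ∀ y ∈ F, l' y ≤ l' g := by
    rw [hl'] at hg; exact hg.2
  have hFmem : ∀ y ∈ convexHull ℝ (S : Set E), y ∈ F ↔ l y = l g := by
    intro y hy
    refine ⟨fun h => le_antisymm (hg1 y hy) ?_, fun h => ?_⟩
    · rw [hl] at h
      exact h.2 g (hF.subset hgF)
    · rw [hl]
      exact ⟨hy, fun z hz => (hg1 z hz).trans h.ge⟩
  -- With `N` large, `N • l + l'` lets `l` decide first and `l'` break ties within `F`. Finiteness
  -- of `S` makes one `N` suffice.
  have hN : ∃ N : ℝ, ∀ s ∈ S, s ∉ F → l' s - l' g < N * (l g - l s) := by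
    have hev : ∀ᶠ N in Filter.atTop (α := ℝ), ∀ s ∈ S, s ∉ F → l' s - l' g < N * (l g - l s) := by
      rw [Filter.eventually_all_finset]
      intro s hs
      by_cases hsF : s ∈ F
      · exact Filter.Eventually.of_forall fun _ h => absurd hsF h
      · have hsP := subset_convexHull ℝ (S : Set E) hs
        have hlt : 0 < l g - l s := sub_pos.2 (lt_of_le_of_ne (hg1 s hsP)
          fun h => hsF ((hFmem s hsP).2 h))
        filter_upwards [Filter.eventually_gt_atTop ((l' s - l' g) / (l g - l s))] with N hN _
        rwa [div_lt_iff₀ hlt] at hN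
    exact hev.exists
  obtain ⟨N, hN⟩ := hN
  refine ⟨N • l + l', ?_⟩
  have hval : ∀ y, (N • l + l') y = N * l y + l' y := fun y => by simp
  have hmax : ∀ s ∈ S, (N • l + l') s ≤ (N • l + l') g := by
    intro s hs
    rw [hval, hval]
    by_cases hsF : s ∈ F
    · rw [(hFmem s (subset_convexHull ℝ _ hs)).1 hsF]
      linarith [hg2 s hsF]
    · linarith [hN s hs hsF]
  apply Set.Subset.antisymm
  · intro x hx
    have hxF := hG.subset hx
    have hxP := hF.subset hxF
    refine ⟨hxP, fun y hy => ?_⟩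
    have h1 := le_of_mem_convexHull hmax hy
    have h2 : l' g ≤ l' x := by
      rw [hl'] at hx
      exact hx.2 g hgF
    have h3 := (hFmem x hxP).1 hxF
    simp only [hval] at h1 ⊢
    rw [h3]
    linarith
  · rintro x ⟨hxP, hx⟩
    have heq : (N • l + l') x = (N • l + l') g :=
      le_antisymm (le_of_mem_convexHull hmax hxP) (hx g (hF.subset hgF))
    have hxF : x ∈ F := by
      rw [hF.eq_convexHull_filter]
      refine mem_convexHull_filter_of_eq hmax hxP heq _ fun s hs hsg => ?_
      by_contra hsF
      rw [hval, hval] at hsg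
      linarith [hN s hs hsF]
    rw [hval, hval, (hFmem x hxP).1 hxF] at heq
    rw [hl']
    exact ⟨hxF, fun y hy => (hg2 y hy).trans (by linarith)⟩

/-- A vertex of a polytope is the unique maximizer of some functional. -/
lemma exists_strict_support {S : Finset E} {v : E}
    (hv : v ∈ (convexHull ℝ (S : Set E)).extremePoints ℝ) :
    ∃ l : E →L[ℝ] ℝ, ∀ s ∈ S, s ≠ v → l s < l v := by
  classical
  rw [(convex_convexHull ℝ _).mem_extremePoints_iff_mem_sdiff_convexHull_sdiff] at hv
  have hv' : v ∉ convexHull ℝ ((S.erase v : Finset E) : Set E) := fun h =>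
    hv.2 (convexHull_mono (fun s hs => by
      have := Finset.mem_erase.1 hs
      exact ⟨subset_convexHull ℝ _ this.2, this.1⟩) h)
  obtain ⟨l, u, hl, hu⟩ := geometric_hahn_banach_closed_point (convex_convexHull ℝ _)
    (((S.erase v).finite_toSet.isCompact_convexHull (𝕜 := ℝ)).isClosed) hv'
  exact ⟨l, fun s hs hsv =>
    (hl s (subset_convexHull ℝ _ (Finset.mem_erase.2 ⟨hsv, hs⟩))).trans hu⟩

lemma convexHull_extremePoints_of_finite {S : Set E} (hS : S.Finite) :
    convexHull ℝ ((convexHull ℝ S).extremePoints ℝ) = convexHull ℝ S := by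
  have hfin : ((convexHull ℝ S).extremePoints ℝ).Finite :=
    hS.subset extremePoints_convexHull_subset
  have := closure_convexHull_extremePoints (hS.isCompact_convexHull (𝕜 := ℝ)) (convex_convexHull ℝ S)
  rwa [(hfin.isCompact_convexHull (𝕜 := ℝ)).isClosed.closure_eq] at this

variable [FiniteDimensional ℝ E]

lemma subset_of_mem_intrinsicInterior {P F G : Set E} (hF : IsExposed ℝ P F) (hG : Convex ℝ G)
    (hGP : G ⊆ P) {x : E} (hx : x ∈ intrinsicInterior ℝ G) (hxF : x ∈ F) : G ⊆ F := by
  intro y hy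
  obtain ⟨l, hl⟩ := hF ⟨x, hxF⟩
  obtain ⟨ε, hε, hmem⟩ := ((mem_intrinsicInterior_iff hG).1 hx).2 y hy
  rw [hl] at hxF ⊢
  have h1 := hxF.2 _ (hGP hmem)
  simp only [map_add, map_smul, map_sub, smul_eq_mul] at h1
  have h2 : l x ≤ l y := by
    by_contra h
    nlinarith [mul_pos hε (sub_pos.2 (not_le.1 h))]
  exact ⟨hGP hy, fun z hz => (hxF.2 z hz).trans h2⟩

/-- Every point of a polytope lies in the relative interior of a face. -/
lemma exists_face_mem_intrinsicInterior {S : Finset E} {F : Set E}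
    (hF : IsExposed ℝ (convexHull ℝ (S : Set E)) F) {x : E} (hx : x ∈ F) :
    ∃ G ⊆ F, IsExposed ℝ (convexHull ℝ (S : Set E)) G ∧ x ∈ intrinsicInterior ℝ G := by
  classical
  -- Outside the relative interior, `x` lies on a proper face of `F`, which contains fewer points of
  -- `S`.
  induction hn : (S.filter (· ∈ F)).card using Nat.strong_induction_on generalizing F with
  | _ n ih =>
    by_cases hxi : x ∈ intrinsicInterior ℝ F
    · exact ⟨F, subset_rfl, hF, hxi⟩
    have hFc := hF.convex (convex_convexHull ℝ _)
    obtain ⟨l, hl, y, hy, hly⟩ := exists_support_of_notMem_intrinsicInterior hFc hx hxi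
    have hGF : IsExposed ℝ F (l.toExposed F) := ContinuousLinearMap.toExposed.isExposed
    have hG := hF.trans_of_polytope hGF
    have hxG : x ∈ l.toExposed F := ⟨hx, hl⟩
    have hlt : (S.filter (· ∈ l.toExposed F)).card < n := by
      rw [← hn]
      refine Finset.card_lt_card (Finset.ssubset_iff_subset_ne.2 ⟨fun s hs => ?_, fun h => ?_⟩)
      · rw [Finset.mem_filter] at hs ⊢
        exact ⟨hs.1, hGF.subset hs.2⟩
      · have h1 := hF.eq_convexHull_filter
        rw [← h, ← hG.eq_convexHull_filter] at h1
        rw [h1] at hy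
        exact absurd (hy.2 x hx) (not_le.2 hly)
    obtain ⟨G, hGs, hGe, hGx⟩ := ih _ hlt hG hxG rfl
    exact ⟨G, hGs.trans hGF.subset, hGe, hGx⟩

lemma face_eq_of_mem_intrinsicInterior {S : Finset E} {F G : Set E}
    (hF : IsExposed ℝ (convexHull ℝ (S : Set E)) F)
    (hG : IsExposed ℝ (convexHull ℝ (S : Set E)) G) {x : E} (hxF : x ∈ intrinsicInterior ℝ F)
    (hxG : x ∈ intrinsicInterior ℝ G) : F = G :=
  Set.Subset.antisymm
    (subset_of_mem_intrinsicInterior hG (hF.convex (convex_convexHull ℝ _)) hF.subset hxF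
      (intrinsicInterior_subset hxG))
    (subset_of_mem_intrinsicInterior hF (hG.convex (convex_convexHull ℝ _)) hG.subset hxG
      (intrinsicInterior_subset hxF))

/-- Only the vertices are known to be integral, so the given generators are replaced by the extreme
points, which have the same hull by Krein–Milman. -/
lemma IsLatticePolytope.exists_finset {d : ℕ} {P : Set (Fin d → ℝ)} (hP : IsLatticePolytope P) :
    ∃ S : Finset (Fin d → ℝ), S.Nonempty ∧ (∀ s ∈ S, s ∈ intLattice d) ∧
      P = convexHull ℝ (S : Set (Fin d → ℝ)) := by
  obtain ⟨T, hT, hne, rfl⟩ := hP.exists_hull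
  have hfin := hT.subset (extremePoints_convexHull_subset (𝕜 := ℝ) (A := T))
  refine ⟨hfin.toFinset, ?_, fun s hs => hP.vertices_integral s (hfin.mem_toFinset.1 hs), ?_⟩
  · rw [Set.Finite.toFinset_nonempty]
    exact (hT.isCompact_convexHull (𝕜 := ℝ)).extremePoints_nonempty hne.convexHull
  · rw [hfin.coe_toFinset, convexHull_extremePoints_of_finite hT]

end FacesOfPolytopes

/-! ### Face counts in simple polytopes -/

section SimplePolytopes

variable {E : Type*} [NormedAddCommGroup E] [NormedSpace ℝ E]

lemma LinearIndependent.exists_dual_eq [FiniteDimensional ℝ E] {ι : Type*} [Fintype ι] {w : ι → E}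
    (hw : LinearIndependent ℝ w) (a : ι → ℝ) : ∃ l : E →L[ℝ] ℝ, ∀ i, l (w i) = a i := by
  let b := Module.Basis.span hw
  obtain ⟨g, hg⟩ := LinearMap.exists_extend (b.constr ℝ a)
  refine ⟨g.toContinuousLinearMap, fun i => ?_⟩
  have h1 := LinearMap.congr_fun hg (b i)
  rw [Module.Basis.constr_basis] at h1
  rw [← h1]
  simp [b, Module.Basis.span_apply]

/-- At the vertex `v`, the tangent cone of `P` is the simplicial cone spanned by the linearly
independent vectors `w i`. -/
structure IsSimplicialAt {ι : Type*} [Fintype ι] (P : Set E) (v : E) (w : ι → E) : Prop where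
  mem : v ∈ P
  linearIndependent : LinearIndependent ℝ w
  sub_mem : ∀ y ∈ P, y - v ∈ genCone w
  exists_add_mem : ∀ i, ∃ δ > (0 : ℝ), v + δ • w i ∈ P

/-- The face of `P` at `v` spanned by the directions indexed by `J`. -/
def spannedFace {ι : Type*} (P : Set E) (v : E) (w : ι → E) (J : Finset ι) : Set E :=
  {y ∈ P | y - v ∈ Submodule.span ℝ (w '' J)}

namespace IsSimplicialAt

variable {ι : Type*} [Fintype ι] {P : Set E} {v : E} {w : ι → E}

lemma mem_spannedFace (h : IsSimplicialAt P v w) (J : Finset ι) : v ∈ spannedFace P v w J :=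
  ⟨h.mem, by simp⟩

lemma sum_mem_span_iff (h : IsSimplicialAt P v w) {c : ι → ℝ} {J : Finset ι} :
    ∑ i, c i • w i ∈ Submodule.span ℝ (w '' J) ↔ ∀ i ∉ J, c i = 0 := by
  refine ⟨fun hmem i hi => ?_, fun hc => sum_smul_mem_span fun i hi => hc i (by simpa using hi)⟩
  obtain ⟨c', hc', hs⟩ := exists_sum_smul_of_mem_span hmem
  have := Fintype.linearIndependent_iff.1 h.linearIndependent (fun i => c i - c' i)
    (by simp [sub_smul, Finset.sum_sub_distrib, hs]) i
  rw [hc' i (by simpa using hi)] at this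
  simpa using this

/-- A functional maximal at `v` is nonpositive on every `w i`, so its maximizers are the points
using only directions on which it vanishes. -/
lemma eq_spannedFace (h : IsSimplicialAt P v w) {F : Set E} (hF : IsExposed ℝ P F) (hv : v ∈ F) :
    ∃ J : Finset ι, F = spannedFace P v w J := by
  classical
  obtain ⟨l, hl⟩ := hF ⟨v, hv⟩
  have hmax : ∀ y ∈ P, l y ≤ l v := by rw [hl] at hv; exact hv.2
  have hle : ∀ i, l (w i) ≤ 0 := fun i => by
    obtain ⟨δ, hδ, hmem⟩ := h.exists_add_mem i
    have := hmax _ hmem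
    rw [map_add, map_smul, smul_eq_mul] at this
    by_contra hpos
    nlinarith [mul_pos hδ (not_le.1 hpos)]
  refine ⟨Finset.univ.filter fun i => l (w i) = 0, ?_⟩
  have key : ∀ y ∈ P, l v ≤ l y ↔
      y - v ∈ Submodule.span ℝ (w '' (Finset.univ.filter fun i => l (w i) = 0 : Finset ι)) := by
    intro y hy
    obtain ⟨c, hc, hcy⟩ := h.sub_mem y hy
    rw [← hcy, h.sum_mem_span_iff]
    have hly : l y = l v + ∑ i, c i * l (w i) := by
      rw [← sub_eq_iff_eq_add', ← map_sub, ← hcy, map_sum]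
      simp
    rw [hly]
    have hterm : ∀ i ∈ Finset.univ, c i * l (w i) ≤ 0 := fun i _ =>
      mul_nonpos_of_nonneg_of_nonpos (hc i) (hle i)
    constructor
    · intro hge i hi
      have h0 : ∑ i, c i * l (w i) = 0 := le_antisymm (Finset.sum_nonpos hterm) (by linarith)
      rw [Finset.sum_eq_zero_iff_of_nonpos hterm] at h0
      exact (mul_eq_zero.1 (h0 i (Finset.mem_univ i))).resolve_right (by simpa using hi)
    · intro hz
      rw [Finset.sum_eq_zero fun i _ => ?_, add_zero]
      by_cases hi : l (w i) = 0
      · rw [hi, mul_zero]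
      · rw [hz i (by simpa using hi), zero_mul]
  ext y
  rw [hl]
  constructor
  · rintro ⟨hy, hy'⟩
    exact ⟨hy, (key y hy).1 (hy' v h.mem)⟩
  · rintro ⟨hy, hy'⟩
    exact ⟨hy, fun z hz => (hmax z hz).trans ((key y hy).2 hy')⟩

lemma isExposed_spannedFace [FiniteDimensional ℝ E] (h : IsSimplicialAt P v w) (J : Finset ι) :
    IsExposed ℝ P (spannedFace P v w J) := by
  classical
  intro _
  -- This functional drops from its value at `v` by exactly the sum of the coefficients outside `J`.
  obtain ⟨l, hl⟩ := h.linearIndependent.exists_dual_eq fun i => if i ∈ J then 0 else -1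
  have hval : ∀ (y : E) (c : ι → ℝ), ∑ i, c i • w i = y - v →
      l y = l v - ∑ i, if i ∈ J then 0 else c i := by
    intro y c hcy
    have h1 : l y - l v = ∑ i, c i * (if i ∈ J then 0 else -1) := by
      rw [← map_sub, ← hcy, map_sum]
      simp [hl]
    have h2 : ∑ i, c i * (if i ∈ J then (0 : ℝ) else -1) = -∑ i, if i ∈ J then 0 else c i := by
      rw [← Finset.sum_neg_distrib]
      exact Finset.sum_congr rfl fun i _ => by split_ifs <;> simp
    linarith
  have hnn : ∀ c : ι → ℝ, (∀ i, 0 ≤ c i) → ∀ i ∈ Finset.univ, 0 ≤ if i ∈ J then 0 else c i :=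
    fun c hc i _ => by split_ifs <;> simp [hc i]
  have hmax : ∀ y ∈ P, l y ≤ l v := by
    intro y hy
    obtain ⟨c, hc, hcy⟩ := h.sub_mem y hy
    rw [hval y c hcy]
    linarith [Finset.sum_nonneg (hnn c hc)]
  refine ⟨l, ?_⟩
  ext y
  constructor
  · rintro ⟨hy, hyJ⟩
    refine ⟨hy, fun z hz => (hmax z hz).trans ?_⟩
    obtain ⟨c, hc, hcy⟩ := h.sub_mem y hy
    rw [← hcy, h.sum_mem_span_iff] at hyJ
    rw [hval y c hcy, Finset.sum_eq_zero fun i _ => ?_, sub_zero]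
    split_ifs with hi
    · rfl
    · exact hyJ i hi
  · rintro ⟨hy, hymax⟩
    refine ⟨hy, ?_⟩
    obtain ⟨c, hc, hcy⟩ := h.sub_mem y hy
    rw [← hcy, h.sum_mem_span_iff]
    have h1 := hymax v h.mem
    rw [hval y c hcy] at h1
    have h0 : (∑ i, if i ∈ J then 0 else c i) = 0 :=
      le_antisymm (by linarith) (Finset.sum_nonneg (hnn c hc))
    rw [Finset.sum_eq_zero_iff_of_nonneg (hnn c hc)] at h0
    intro i hi
    simpa [hi] using h0 i (Finset.mem_univ i)

lemma add_mem_spannedFace_iff (h : IsSimplicialAt P v w) {J : Finset ι} {i : ι} {δ : ℝ}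
    (hδ : 0 < δ) (hmem : v + δ • w i ∈ P) : v + δ • w i ∈ spannedFace P v w J ↔ i ∈ J := by
  classical
  have h1 : v + δ • w i - v = ∑ j, (Pi.single i δ : ι → ℝ) j • w j := by
    rw [Finset.sum_eq_single i] <;> simp +contextual
  rw [spannedFace, Set.mem_sep_iff, h1, h.sum_mem_span_iff]
  refine ⟨fun ⟨_, hz⟩ => ?_, fun hi => ⟨hmem, fun j hj => ?_⟩⟩
  · by_contra hi
    have := hz i hi
    rw [Pi.single_eq_same] at this
    exact hδ.ne' this
  · exact Pi.single_eq_of_ne (by rintro rfl; exact hj hi) _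

lemma spannedFace_subset_iff (h : IsSimplicialAt P v w) {J K : Finset ι} :
    spannedFace P v w J ⊆ spannedFace P v w K ↔ J ⊆ K := by
  refine ⟨fun hsub i hi => ?_, fun hJK y hy =>
    ⟨hy.1, Submodule.span_mono (Set.image_mono (by exact_mod_cast hJK)) hy.2⟩⟩
  obtain ⟨δ, hδ, hmem⟩ := h.exists_add_mem i
  exact (h.add_mem_spannedFace_iff hδ hmem).1 (hsub ((h.add_mem_spannedFace_iff hδ hmem).2 hi))

lemma finrank_vectorSpan_spannedFace (h : IsSimplicialAt P v w) (J : Finset ι) :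
    Module.finrank ℝ (vectorSpan ℝ (spannedFace P v w J)) = J.card := by
  classical
  have h1 : vectorSpan ℝ (spannedFace P v w J) = Submodule.span ℝ (w '' J) := by
    rw [vectorSpan_eq_span_vsub_set_right ℝ (h.mem_spannedFace J)]
    apply le_antisymm
    · rw [Submodule.span_le]
      rintro _ ⟨y, hy, rfl⟩
      exact hy.2
    · rw [Submodule.span_le]
      rintro _ ⟨i, hi, rfl⟩
      obtain ⟨δ, hδ, hmem⟩ := h.exists_add_mem i
      have h2 : δ • w i ∈ Submodule.span ℝ ((· -ᵥ v) '' spannedFace P v w J) :=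
        Submodule.subset_span ⟨v + δ • w i, (h.add_mem_spannedFace_iff hδ hmem).2 hi, by simp⟩
      exact (Submodule.smul_mem_iff _ hδ.ne').1 h2
  rw [h1, Set.image_eq_range]
  have h2 := h.linearIndependent.comp (fun i : (J : Set ι) => (i : ι)) Subtype.val_injective
  have h3 := finrank_span_eq_card h2
  exact h3.trans (by simp)

end IsSimplicialAt

/-- The number of `p`-faces through a given `q`-face at a simplicial vertex. -/
lemma IsSimplicialAt.ncard_faces {d : ℕ} {ι : Type*} [Fintype ι] {P : Set (Fin d → ℝ)}
    {v : Fin d → ℝ} {w : ι → Fin d → ℝ} (h : IsSimplicialAt P v w) {p q : ℕ}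
    (hp : p ≤ Fintype.card ι) {G : Set (Fin d → ℝ)} (hG : G ∈ faces P q) (hv : v ∈ G) :
    {F ∈ faces P p | G ⊆ F}.ncard =
      (Fintype.card ι - q).choose (Fintype.card ι - p) := by
  classical
  obtain ⟨J, rfl⟩ := h.eq_spannedFace hG.2.1 hv
  have hJ : J.card = q := by rw [← h.finrank_vectorSpan_spannedFace]; exact hG.2.2
  -- Indexing faces by complements gives the binomial with lower entry `card ι - p`, which is
  -- correctly zero for `q > p`; truncated `p - q` would not be.
  have himg : {F ∈ faces P p | spannedFace P v w J ⊆ F} =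
      (fun K : Finset ι => spannedFace P v w Kᶜ) ''
        ((Jᶜ.powersetCard (Fintype.card ι - p) : Finset (Finset ι)) : Set (Finset ι)) := by
    ext F
    constructor
    · rintro ⟨⟨hne, hF, hdim⟩, hsub⟩
      obtain ⟨K, rfl⟩ := h.eq_spannedFace hF (hsub hv)
      have hK : K.card = p := by rw [← h.finrank_vectorSpan_spannedFace]; exact hdim
      refine ⟨Kᶜ, ?_, by simp⟩
      rw [Finset.mem_coe, Finset.mem_powersetCard, Finset.card_compl, hK]
      exact ⟨Finset.compl_subset_compl.2 (h.spannedFace_subset_iff.1 hsub), rfl⟩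
    · rintro ⟨K, hK, rfl⟩
      rw [Finset.mem_coe, Finset.mem_powersetCard] at hK
      refine ⟨⟨⟨v, h.mem_spannedFace _⟩, h.isExposed_spannedFace _, ?_⟩,
        h.spannedFace_subset_iff.2 ?_⟩
      · rw [polyDim, h.finrank_vectorSpan_spannedFace, Finset.card_compl, hK.2]
        omega
      · rw [← Finset.compl_subset_compl, compl_compl]
        exact hK.1
  rw [himg, Set.ncard_image_of_injective, Set.ncard_coe_finset, Finset.card_powersetCard,
    Finset.card_compl, hJ]
  intro K K' hKK
  have h1 : spannedFace P v w Kᶜ = spannedFace P v w K'ᶜ := hKK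
  have h2 : Kᶜ = K'ᶜ := Finset.Subset.antisymm (h.spannedFace_subset_iff.1 h1.subset)
    (h.spannedFace_subset_iff.1 h1.superset)
  exact compl_injective h2

lemma mem_genCone_of_mem_convexHull {X : Finset E} {y : E} (hy : y ∈ convexHull ℝ (X : Set E)) :
    y ∈ genCone (fun x : X => (x : E)) := by
  rw [Finset.mem_convexHull'] at hy
  obtain ⟨w, hw, -, hwy⟩ := hy
  exact ⟨fun x => w x, fun x => hw x x.2, by
    rw [← hwy]; exact Finset.sum_coe_sort X fun x => w x • x⟩

/-- The exposed face cut out at `v` by an extreme point of the vertex figure is an edge. -/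
lemma exists_edge {d : ℕ} {S : Finset (Fin d → ℝ)} {v : Fin d → ℝ} (hvS : v ∈ S)
    {l : (Fin d → ℝ) →L[ℝ] ℝ} (hl : ∀ s ∈ S, s ≠ v → l s < l v) {x : Fin d → ℝ}
    {m : (Fin d → ℝ) →L[ℝ] ℝ}
    (hx : ∃ s ∈ S, s ≠ v ∧ (l v - l s)⁻¹ • (s - v) = x)
    (hm : ∀ s ∈ S, s ≠ v → (l v - l s)⁻¹ • (s - v) ≠ x → m ((l v - l s)⁻¹ • (s - v)) < m x) :
    ∃ F ∈ faces (convexHull ℝ (S : Set (Fin d → ℝ))) 1, v ∈ F ∧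
      vectorSpan ℝ F = Submodule.span ℝ {x} := by
  classical
  set P := convexHull ℝ (S : Set (Fin d → ℝ)) with hP
  -- Since `l x = -1`, this functional vanishes on `x`. On the other points of the vertex figure it
  -- equals `m` minus `m x`, hence is negative.
  let l' : (Fin d → ℝ) →L[ℝ] ℝ := m + (m x) • l
  have hs' : ∀ s ∈ S, s ≠ v → s - v = (l v - l s) • ((l v - l s)⁻¹ • (s - v)) := fun s hs hsv => by
    rw [smul_inv_smul₀ (sub_pos.2 (hl s hs hsv)).ne']
  have hval : ∀ s ∈ S, s ≠ v →
      l' s - l' v = (l v - l s) * (m ((l v - l s)⁻¹ • (s - v)) - m x) := by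
    intro s hs hsv
    have h1 := congrArg m (hs' s hs hsv)
    rw [map_smul, smul_eq_mul, map_sub] at h1
    simp only [l', add_apply, smul_apply, smul_eq_mul]
    linear_combination h1
  have hmax : ∀ s ∈ S, l' s ≤ l' v := by
    intro s hs
    by_cases hsv : s = v
    · rw [hsv]
    have h1 := hval s hs hsv
    have h2 := sub_pos.2 (hl s hs hsv)
    by_cases hsx : (l v - l s)⁻¹ • (s - v) = x
    · rw [hsx, sub_self, mul_zero] at h1; linarith
    · nlinarith [mul_pos h2 (sub_pos.2 (hm s hs hsv hsx))]
  have hvP : v ∈ P := subset_convexHull ℝ _ hvS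
  have hvF : v ∈ l'.toExposed P := ⟨hvP, fun y hy => le_of_mem_convexHull hmax hy⟩
  have hFeq : ∀ y ∈ l'.toExposed P, l' y = l' v := fun y hy =>
    le_antisymm (hvF.2 y hy.1) (hy.2 v hvP)
  have hexp : IsExposed ℝ P (l'.toExposed P) := ContinuousLinearMap.toExposed.isExposed
  have hspan : vectorSpan ℝ (l'.toExposed P) = Submodule.span ℝ {x} := by
    apply le_antisymm
    · rw [hexp.eq_convexHull_filter, ← direction_affineSpan, affineSpan_convexHull,
        direction_affineSpan, vectorSpan_eq_span_vsub_set_right ℝ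
          (p := v) (by exact_mod_cast Finset.mem_filter.2 ⟨hvS, hvF⟩), Submodule.span_le]
      rintro _ ⟨s, hs, rfl⟩
      obtain ⟨hs, hsF⟩ := Finset.mem_filter.1 hs
      show s - v ∈ _
      by_cases hsv : s = v
      · rw [hsv, sub_self]; exact zero_mem _
      by_cases hsx : (l v - l s)⁻¹ • (s - v) = x
      · rw [hs' s hs hsv, hsx]
        exact Submodule.smul_mem _ _ (Submodule.mem_span_singleton_self x)
      · have h1 := hval s hs hsv
        rw [hFeq s hsF, sub_self] at h1
        have h2 := mul_pos (sub_pos.2 (hl s hs hsv)) (sub_pos.2 (hm s hs hsv hsx))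
        nlinarith
    · obtain ⟨s, hs, hsv, hsx⟩ := hx
      rw [Submodule.span_singleton_le_iff_mem, ← hsx]
      refine Submodule.smul_mem _ _ (vsub_mem_vectorSpan ℝ ?_ hvF)
      have h1 := hval s hs hsv
      rw [hsx, sub_self, mul_zero, sub_eq_zero] at h1
      exact ⟨subset_convexHull ℝ _ hs, fun y hy => (hvF.2 y hy).trans h1.ge⟩
  refine ⟨_, ⟨⟨v, hvF⟩, hexp, ?_⟩, hvF, hspan⟩
  rw [polyDim, hspan]
  refine finrank_span_singleton ?_
  obtain ⟨s, hs, hsv, rfl⟩ := hx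
  exact smul_ne_zero (inv_ne_zero (sub_pos.2 (hl s hs hsv)).ne') (sub_ne_zero.2 hsv)

/-- The tangent cones of a simple polytope are simplicial. -/
lemma IsSimplePolytope.exists_isSimplicialAt {d : ℕ} {S : Finset (Fin d → ℝ)}
    (hs : IsSimplePolytope (convexHull ℝ (S : Set (Fin d → ℝ)))) {v : Fin d → ℝ}
    (hv : v ∈ (convexHull ℝ (S : Set (Fin d → ℝ))).extremePoints ℝ) :
    ∃ X : Finset (Fin d → ℝ), X.card = polyDim (convexHull ℝ (S : Set (Fin d → ℝ))) ∧
      IsSimplicialAt (convexHull ℝ (S : Set (Fin d → ℝ))) v (fun x : X => (x : Fin d → ℝ)) := by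
  classical
  have hvS : v ∈ S := by exact_mod_cast extremePoints_convexHull_subset hv
  obtain ⟨l, hl⟩ := exists_strict_support hv
  -- The vertex figure: directions from `v` are scaled to the hyperplane `l = -1`. Its extreme
  -- points `X` generate the tangent cone and inject into the edges at `v`, so simplicity gives
  -- `X.card ≤ polyDim P`. As `X` spans all directions of `P`, it is independent with exactly that
  -- many elements.
  let φ : (Fin d → ℝ) → Fin d → ℝ := fun s => (l v - l s)⁻¹ • (s - v)
  let T : Finset (Fin d → ℝ) := (S.erase v).image φ
  have hT : ∀ s ∈ S, s ≠ v → φ s ∈ T := fun s hs hsv =>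
    Finset.mem_image_of_mem φ (Finset.mem_erase.2 ⟨hsv, hs⟩)
  have hφ : ∀ s ∈ S, s ≠ v → s - v = (l v - l s) • φ s := fun s hs hsv => by
    simp only [φ]
    rw [smul_inv_smul₀ (sub_pos.2 (hl s hs hsv)).ne']
  have hlT : ∀ x ∈ T, l x = -1 := by
    intro x hx
    obtain ⟨s, hs, rfl⟩ := Finset.mem_image.1 hx
    obtain ⟨hsv, hs⟩ := Finset.mem_erase.1 hs
    have := sub_pos.2 (hl s hs hsv)
    simp only [φ, map_smul, map_sub, smul_eq_mul]
    field_simp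
    ring
  have hfin : ((convexHull ℝ (T : Set (Fin d → ℝ))).extremePoints ℝ).Finite :=
    T.finite_toSet.subset extremePoints_convexHull_subset
  set X := hfin.toFinset with hX
  have hXT : X ⊆ T := fun x hx => by
    exact_mod_cast extremePoints_convexHull_subset (hfin.mem_toFinset.1 hx)
  have hXconv : convexHull ℝ (X : Set (Fin d → ℝ)) = convexHull ℝ (T : Set (Fin d → ℝ)) := by
    rw [hX, hfin.coe_toFinset, convexHull_extremePoints_of_finite T.finite_toSet]
  have hedge : ∀ x ∈ X, ∃ F ∈ faces (convexHull ℝ (S : Set (Fin d → ℝ))) 1, v ∈ F ∧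
      vectorSpan ℝ F = Submodule.span ℝ {x} := by
    intro x hx
    obtain ⟨m, hm⟩ := exists_strict_support (hfin.mem_toFinset.1 hx)
    refine exists_edge (m := m) hvS hl ?_ fun s hs hsv hsx => hm _ (hT s hs hsv) hsx
    obtain ⟨s, hs, hsx⟩ := Finset.mem_image.1 (hXT hx)
    obtain ⟨hsv, hs⟩ := Finset.mem_erase.1 hs
    exact ⟨s, hs, hsv, hsx⟩
  choose! e he hve hspan using hedge
  have hinj : Set.InjOn e X := by
    intro x hx y hy hxy
    have h1 : Submodule.span ℝ {x} = Submodule.span ℝ {y} := by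
      rw [← hspan x hx, ← hspan y hy, hxy]
    have h2 : x ∈ Submodule.span ℝ {y} := h1 ▸ Submodule.mem_span_singleton_self x
    obtain ⟨c, rfl⟩ := Submodule.mem_span_singleton.1 h2
    have h3 := hlT _ (hXT hx)
    rw [map_smul, hlT y (hXT hy), smul_eq_mul] at h3
    obtain rfl : c = 1 := by linarith
    rw [one_smul]
  have hcard : X.card ≤ polyDim (convexHull ℝ (S : Set (Fin d → ℝ))) := by
    have h1 : (X.card : ℕ∞) ≤ {F ∈ faces (convexHull ℝ (S : Set (Fin d → ℝ))) 1 | v ∈ F}.encard := by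
      rw [← Set.encard_coe_eq_coe_finsetCard, ← hinj.encard_image]
      refine Set.encard_le_encard ?_
      rintro _ ⟨x, hx, rfl⟩
      exact ⟨he x hx, hve x hx⟩
    rw [hs v hv] at h1
    exact_mod_cast h1
  have hcone : ∀ s ∈ S, s - v ∈ genCone (fun x : X => (x : Fin d → ℝ)) := by
    intro s hs
    by_cases hsv : s = v
    · rw [hsv, sub_self]
      exact ⟨0, fun _ => le_rfl, by simp⟩
    · rw [hφ s hs hsv]
      refine genCone_smul_mem (sub_pos.2 (hl s hs hsv)).le (mem_genCone_of_mem_convexHull ?_)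
      rw [hXconv]
      exact subset_convexHull ℝ _ (hT s hs hsv)
  have hvec : vectorSpan ℝ (convexHull ℝ (S : Set (Fin d → ℝ))) ≤
      Submodule.span ℝ (Set.range fun x : X => (x : Fin d → ℝ)) := by
    rw [← direction_affineSpan, affineSpan_convexHull, direction_affineSpan,
      vectorSpan_eq_span_vsub_set_right ℝ (show v ∈ (S : Set (Fin d → ℝ)) from hvS),
      Submodule.span_le]
    rintro _ ⟨s, hs, rfl⟩
    exact mem_span_of_mem_genCone (hcone s hs)
  have hdim : polyDim (convexHull ℝ (S : Set (Fin d → ℝ))) ≤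
      Module.finrank ℝ (Submodule.span ℝ (Set.range fun x : X => (x : Fin d → ℝ))) :=
    Submodule.finrank_mono hvec
  have hle := finrank_range_le_card (R := ℝ) (fun x : X => (x : Fin d → ℝ))
  rw [Set.finrank, Fintype.card_coe] at hle
  refine ⟨X, by omega, extremePoints_subset hv, ?_, fun y hy => ?_, fun x => ?_⟩
  · rw [linearIndependent_iff_card_le_finrank_span, Fintype.card_coe, Set.finrank]
    omega
  · rw [Finset.mem_convexHull'] at hy
    obtain ⟨c, hc, hc1, hcy⟩ := hy
    have h1 : y - v = ∑ s ∈ S, c s • (s - v) := by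
      simp only [smul_sub, Finset.sum_sub_distrib, hcy, ← Finset.sum_smul, hc1, one_smul]
    rw [h1]
    have hsum : ∀ S' ⊆ S, ∑ s ∈ S', c s • (s - v) ∈ genCone (fun x : X => (x : Fin d → ℝ)) := by
      intro S'
      induction S' using Finset.induction_on with
      | empty => exact fun _ => ⟨0, fun _ => le_rfl, by simp⟩
      | insert a S' ha ih =>
        intro hsub
        rw [Finset.sum_insert ha]
        have haS := hsub (Finset.mem_insert_self a S')
        exact genCone_add_mem (genCone_smul_mem (hc a haS) (hcone a haS))
          (ih fun b hb => hsub (Finset.mem_insert_of_mem hb))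
    exact hsum S subset_rfl
  · obtain ⟨s, hs, hsx⟩ := Finset.mem_image.1 (hXT x.2)
    obtain ⟨hsv, hs⟩ := Finset.mem_erase.1 hs
    refine ⟨l v - l s, sub_pos.2 (hl s hs hsv), ?_⟩
    rw [← hsx, ← hφ s hs hsv, add_sub_cancel]
    exact subset_convexHull ℝ _ hs

/-- In a simple `n`-polytope, each `q`-face lies on `n - q` choose `n - p` faces of dimension
`p`. -/
lemma IsSimplePolytope.ncard_faces {d : ℕ} {S : Finset (Fin d → ℝ)}
    (hs : IsSimplePolytope (convexHull ℝ (S : Set (Fin d → ℝ)))) {p q : ℕ}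
    (hp : p ≤ polyDim (convexHull ℝ (S : Set (Fin d → ℝ)))) {G : Set (Fin d → ℝ)}
    (hG : G ∈ faces (convexHull ℝ (S : Set (Fin d → ℝ))) q) :
    {F ∈ faces (convexHull ℝ (S : Set (Fin d → ℝ))) p | G ⊆ F}.ncard =
      (polyDim (convexHull ℝ (S : Set (Fin d → ℝ))) - q).choose
        (polyDim (convexHull ℝ (S : Set (Fin d → ℝ))) - p) := by
  have hcomp : IsCompact G := hG.2.1.isCompact (S.finite_toSet.isCompact_convexHull (𝕜 := ℝ))
  obtain ⟨v, hv⟩ := hcomp.extremePoints_nonempty hG.1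
  obtain ⟨X, hX, hsimp⟩ := hs.exists_isSimplicialAt
    (hG.2.1.isExtreme.extremePoints_subset_extremePoints hv)
  have := hsimp.ncard_faces (p := p) (by rwa [Fintype.card_coe, hX]) hG (extremePoints_subset hv)
  rwa [Fintype.card_coe, hX] at this

end SimplePolytopes

/-! ### Finite differences and binomial identities -/

section DifferenceCalculus

open Polynomial Finset

/-- The `(p+1)`-st difference of a polynomial of degree at most `p + 1` is constant in `y`. The
factor `X` supplies the `p + 1` of the discriminant number and later kills the value at `0`. -/
lemma sum_choose_mul_X_eval {p : ℕ} {g : ℝ[X]} (hg : g.natDegree ≤ p) (y : ℝ) :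
    ∑ j ∈ range (p + 2), (-1 : ℝ) ^ (p + 1 - j) * ((p + 1).choose j : ℝ) *
      ((y + j) * g.eval (y + j)) = ((p + 1).factorial : ℝ) * g.coeff p := by
  have h1 := fwdDiff_iter_eq_sum_shift (h := (1 : ℝ)) (X * g).eval (p + 1) y
  have h2 : (fwdDiff (1 : ℝ))^[p + 1] (X * g).eval y = ((p + 1).factorial : ℝ) * g.coeff p := by
    have hdeg : (X * g).natDegree ≤ p + 1 := by
      refine natDegree_mul_le.trans ?_
      rw [natDegree_X]
      omega
    rcases hdeg.lt_or_eq with hlt | heq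
    · rw [Polynomial.fwdDiff_iter_eq_zero_of_degree_lt hlt, ← coeff_X_mul,
        coeff_eq_zero_of_natDegree_lt hlt]
      simp
    · have := Polynomial.fwdDiff_iter_degree_eq_factorial (X * g)
      rw [heq] at this
      rw [this, leadingCoeff, heq, coeff_X_mul]
      simp [mul_comm]
  rw [h2] at h1
  rw [h1]
  refine sum_congr rfl fun j _ => ?_
  simp

/-- Up to sign the sum is the `(n-q)`-th difference of `x ↦ x.choose r` at `q + 1`. Each difference
lowers `r` by one, and symmetry of the binomial gives the stated form, which also covers `r < n -
q`, where both sides vanish. -/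
lemma sum_choose_mul_choose {n q r : ℕ} (hq : q ≤ n) (hr : r ≤ n + 1) :
    ∑ p ∈ range (n + 1), (-1 : ℝ) ^ p * ((n - q).choose (n - p) : ℝ) * ((p + 1).choose r : ℝ) =
      (-1) ^ n * ((q + 1).choose (n + 1 - r) : ℝ) := by
  obtain ⟨N, rfl⟩ := Nat.exists_eq_add_of_le hq
  have key : ∑ k ∈ range (N + 1), (-1 : ℤ) ^ (N - k) * (N.choose k : ℤ) *
      (((q + 1 + k).choose r : ℕ) : ℤ) = ((q + 1).choose (q + N + 1 - r) : ℤ) := by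
    have h1 := fwdDiff_iter_eq_sum_shift (h := 1) (fun x : ℕ => (x.choose r : ℤ)) N (q + 1)
    simp only [smul_eq_mul, mul_one] at h1
    rw [← h1]
    rcases le_or_gt N r with h | h
    · obtain ⟨k, rfl⟩ := Nat.exists_eq_add_of_le h
      rw [fwdDiff_iter_choose]
      have h2 : q + N + 1 - (N + k) = q + 1 - k := by omega
      rw [h2, Nat.choose_symm (by omega)]
    · obtain ⟨k, rfl⟩ := Nat.exists_eq_add_of_lt h
      have h3 := fwdDiff_iter_choose 0 r
      rw [add_zero] at h3
      rw [Nat.choose_eq_zero_of_lt (by omega), show r + k + 1 = (k + 1) + r by ring,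
        Function.iterate_add_apply, h3, Function.iterate_succ_apply]
      have h4 : fwdDiff 1 (fun x : ℕ => ((x.choose 0 : ℕ) : ℤ)) = 0 := by
        funext x; simp [fwdDiff]
      rw [h4]
      have h5 := fwdDiff_iter_const_smul (h := 1) (0 : ℤ) (0 : ℕ → ℤ) k
      simp only [zero_smul] at h5
      rw [h5]
      simp
  have key' : ∑ k ∈ range (N + 1), (-1 : ℝ) ^ (N - k) * (N.choose k : ℝ) *
      (((q + 1 + k).choose r : ℕ) : ℝ) = ((q + 1).choose (q + N + 1 - r) : ℝ) := by
    exact_mod_cast key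
  rw [← key', add_assoc, sum_range_add, sum_eq_zero, zero_add, mul_sum]
  · refine sum_congr rfl fun k hk => ?_
    have hk' : k ≤ N := by have := mem_range.1 hk; omega
    rw [show q + N - q = N by omega, show q + N - (q + k) = N - k by omega,
      Nat.choose_symm hk', show q + k + 1 = q + 1 + k by ring]
    have : (-1 : ℝ) ^ (q + N) * (-1) ^ (N - k) = (-1) ^ (q + k) := by
      obtain ⟨j, rfl⟩ := Nat.exists_eq_add_of_le hk'
      rw [show k + j - k = j by omega, ← pow_add, show q + (k + j) + j = (q + k) + 2 * j by ring,
        pow_add, pow_mul]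
      simp
    rw [← this]
    ring
  · intro p hp
    have := mem_range.1 hp
    rw [show q + N - q = N by omega, Nat.choose_eq_zero_of_lt (by omega)]
    simp

/-- The identity behind the discriminant formula: a top difference of `X * g p` is computed from
the values at positive integers, those at negative integers being rewritten by reciprocity. -/
theorem sum_coeff_eq_of_reciprocity {n m : ℕ} (hm : m ≤ n + 1) {g : ℕ → ℝ[X]}
    (hdeg : ∀ p ≤ n, (g p).natDegree ≤ p) {I : ℕ → ℕ → ℝ}
    (hI : ∀ p ≤ n, ∀ k : ℕ, 1 ≤ k → (g p).eval (k : ℝ) = I p k)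
    (hrec : ∀ p ≤ n, ∀ k : ℕ, 1 ≤ k → (-1) ^ p * (g p).eval (-(k : ℝ)) =
      ∑ q ∈ range (n + 1), ((n - q).choose (n - p) : ℝ) * I q k) :
    ∑ p ∈ range (n + 1), (-1 : ℝ) ^ (n - p) * (((p + 1).factorial : ℝ) * (g p).coeff p) =
      ∑ p ∈ range (n + 1), ∑ i ∈ range (n + 1),
        ((-1) ^ (n + 1 + m + (i + 1)) * ((p + 1).choose (m + (i + 1)) : ℝ) +
          (-1) ^ (m + (i + 1)) * ((p + 1).choose (n + 1 - m + (i + 1)) : ℝ)) *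
          ((i + 1 : ℕ) : ℝ) * I p (i + 1) := by
  have hsplit : ∀ p ≤ n, (-1 : ℝ) ^ (n - p) * (((p + 1).factorial : ℝ) * (g p).coeff p) =
      ∑ i ∈ range (n + 1), (-1) ^ (n + 1 + m + (i + 1)) * ((p + 1).choose (m + (i + 1)) : ℝ) *
        ((i + 1 : ℕ) : ℝ) * I p (i + 1) +
      ∑ k ∈ range m, (-1) ^ (n + m + (k + 1)) * ((p + 1).choose (m - (k + 1)) : ℝ) *
        ((k + 1 : ℕ) : ℝ) * (g p).eval (-((k + 1 : ℕ) : ℝ)) := by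
    intro p hp
    rw [← sum_choose_mul_X_eval (hdeg p hp) (-(m : ℝ)), mul_sum]
    -- The range is padded by vanishing binomials so that it no longer depends on `p` and contains
    -- `j = m`.
    have hext : ∑ j ∈ range (p + 2), (-1 : ℝ) ^ (n - p) * ((-1 : ℝ) ^ (p + 1 - j) *
        ((p + 1).choose j : ℝ) * ((-(m : ℝ) + j) * (g p).eval (-(m : ℝ) + j))) =
        ∑ j ∈ range (m + (n + 2)), (-1 : ℝ) ^ (n + 1 + j) *
        ((p + 1).choose j : ℝ) * ((-(m : ℝ) + j) * (g p).eval (-(m : ℝ) + j)) := by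
      have h1 : ∑ j ∈ range (p + 2), (-1 : ℝ) ^ (n - p) * ((-1 : ℝ) ^ (p + 1 - j) *
          ((p + 1).choose j : ℝ) * ((-(m : ℝ) + j) * (g p).eval (-(m : ℝ) + j))) =
          ∑ j ∈ range (p + 2), (-1 : ℝ) ^ (n + 1 + j) *
          ((p + 1).choose j : ℝ) * ((-(m : ℝ) + j) * (g p).eval (-(m : ℝ) + j)) := by
        refine sum_congr rfl fun j hj => ?_
        have hj' : j ≤ p + 1 := by have := mem_range.1 hj; omega
        have : (-1 : ℝ) ^ (n + 1 + j) = (-1 : ℝ) ^ (n - p) * (-1 : ℝ) ^ (p + 1 - j) := by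
          rw [← pow_add, show n + 1 + j = (n - p + (p + 1 - j)) + 2 * j by omega, pow_add, pow_mul]
          simp
        rw [this]
        ring
      rw [h1]
      refine sum_subset (fun j hj => ?_) fun j _ hj => ?_
      · rw [mem_range] at hj ⊢; omega
      · rw [mem_range] at hj
        rw [Nat.choose_eq_zero_of_lt (by omega)]
        simp
    -- Split at `j = m`, where the argument is `0` and the term vanishes: larger `j` give positive
    -- arguments, smaller `j` negative ones.
    rw [hext, sum_range_add, add_comm, sum_range_succ']
    congr 1
    · simp only [add_zero, neg_add_cancel, zero_mul, mul_zero]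
      refine sum_congr rfl fun i _ => ?_
      have h1 : -(m : ℝ) + ((m + (i + 1) : ℕ) : ℝ) = ((i + 1 : ℕ) : ℝ) := by push_cast; ring
      rw [h1, hI p hp _ (by omega), show n + 1 + (m + (i + 1)) = n + 1 + m + (i + 1) by ring]
      ring
    · rw [← sum_range_reflect]
      refine sum_congr rfl fun k hk => ?_
      have hk' : k + 1 ≤ m := mem_range.1 hk
      have h0 : m - 1 - k = m - (k + 1) := by omega
      have h1 : -(m : ℝ) + ((m - (k + 1) : ℕ) : ℝ) = -((k + 1 : ℕ) : ℝ) := by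
        rw [Nat.cast_sub hk']; ring
      rw [h0, h1]
      have h2 : (-1 : ℝ) ^ (n + 1 + (m - (k + 1))) = -(-1) ^ (n + m + (k + 1)) := by
        obtain ⟨j, rfl⟩ := Nat.exists_eq_add_of_le hk'
        rw [show k + 1 + j - (k + 1) = j by omega,
          show n + (k + 1 + j) + (k + 1) = n + j + 2 * (k + 1) by ring, pow_add _ _ (2 * (k + 1)),
          pow_mul, show n + 1 + j = n + j + 1 by ring, pow_succ]
        simp
      rw [h2]
      ring
  have hneg : ∑ p ∈ range (n + 1), ∑ k ∈ range m, (-1 : ℝ) ^ (n + m + (k + 1)) *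
      ((p + 1).choose (m - (k + 1)) : ℝ) * ((k + 1 : ℕ) : ℝ) * (g p).eval (-((k + 1 : ℕ) : ℝ)) =
      ∑ p ∈ range (n + 1), ∑ i ∈ range (n + 1), (-1) ^ (m + (i + 1)) *
        ((p + 1).choose (n + 1 - m + (i + 1)) : ℝ) * ((i + 1 : ℕ) : ℝ) * I p (i + 1) := by
    rw [sum_comm, sum_comm (s := range (n + 1)) (t := range (n + 1))]
    have hzero : ∑ i ∈ range (n + 1), ∑ q ∈ range (n + 1), (-1 : ℝ) ^ (m + (i + 1)) *
        ((q + 1).choose (n + 1 - m + (i + 1)) : ℝ) * ((i + 1 : ℕ) : ℝ) * I q (i + 1) =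
        ∑ i ∈ range m, ∑ q ∈ range (n + 1), (-1 : ℝ) ^ (m + (i + 1)) *
        ((q + 1).choose (n + 1 - m + (i + 1)) : ℝ) * ((i + 1 : ℕ) : ℝ) * I q (i + 1) := by
      refine (sum_subset (fun j hj => ?_) fun j _ hj => sum_eq_zero fun q hq => ?_).symm
      · rw [mem_range] at hj ⊢; omega
      · rw [mem_range] at hj hq
        dsimp only
        rw [Nat.choose_eq_zero_of_lt (by omega)]
        simp
    rw [hzero]
    refine sum_congr rfl fun k hk => ?_
    have hk' : k + 1 ≤ m := mem_range.1 hk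
    have h1 : ∀ p ∈ range (n + 1), (-1 : ℝ) ^ (n + m + (k + 1)) *
        ((p + 1).choose (m - (k + 1)) : ℝ) * ((k + 1 : ℕ) : ℝ) * (g p).eval (-((k + 1 : ℕ) : ℝ)) =
        ∑ q ∈ range (n + 1), (-1 : ℝ) ^ (n + m + (k + 1)) * ((k + 1 : ℕ) : ℝ) * I q (k + 1) *
          ((-1 : ℝ) ^ p * ((n - q).choose (n - p) : ℝ) * ((p + 1).choose (m - (k + 1)) : ℝ)) := by
      intro p hp
      have hr := hrec p (by have := mem_range.1 hp; omega) (k + 1) (by omega)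
      have hsq : (-1 : ℝ) ^ p * (-1) ^ p = 1 := by rw [← mul_pow]; simp
      have hr' : (g p).eval (-((k + 1 : ℕ) : ℝ)) = (-1 : ℝ) ^ p *
          ∑ q ∈ range (n + 1), ((n - q).choose (n - p) : ℝ) * I q (k + 1) := by
        rw [← hr, ← mul_assoc, hsq, one_mul]
      rw [hr', mul_sum, mul_sum]
      exact sum_congr rfl fun q _ => by ring
    rw [sum_congr rfl h1, sum_comm]
    refine sum_congr rfl fun q hq => ?_
    rw [← mul_sum, sum_choose_mul_choose (by have := mem_range.1 hq; omega) (by omega)]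
    have h2 : n + 1 - (m - (k + 1)) = n + 1 - m + (k + 1) := by omega
    have h3 : (-1 : ℝ) ^ (n + m + (k + 1)) * (-1) ^ n = (-1) ^ (m + (k + 1)) := by
      rw [← pow_add, show n + m + (k + 1) + n = m + (k + 1) + 2 * n by ring, pow_add, pow_mul]
      simp
    rw [h2, ← h3]
    ring
  calc _ = ∑ p ∈ range (n + 1), _ := sum_congr rfl fun p hp =>
        hsplit p (by have := mem_range.1 hp; omega)
    _ = _ := by
      rw [sum_add_distrib, hneg, ← sum_add_distrib]
      refine sum_congr rfl fun p _ => ?_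
      rw [← sum_add_distrib]
      exact sum_congr rfl fun i _ => by ring

end DifferenceCalculus

/-! ### Lattice volume as leading Ehrhart coefficient -/

section LatticeVolume

open Polynomial MeasureTheory Filter Topology

lemma tendsto_eval_div_pow {f : ℝ[X]} {p : ℕ} (hf : f.natDegree ≤ p) :
    Tendsto (fun n : ℕ => f.eval (n : ℝ) / (n : ℝ) ^ p) atTop (𝓝 (f.coeff p)) := by
  have h : Tendsto (fun x : ℝ => f.eval x / (X ^ p : ℝ[X]).eval x) atTop (𝓝 (f.coeff p)) := by
    by_cases hd : f.degree = p
    · have h1 := f.div_tendsto_atTop_leadingCoeff_div_of_degree_eq (X ^ p) (by rw [hd, degree_X_pow])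
      have h2 : f.natDegree = p := natDegree_eq_of_degree_eq_some hd
      rw [leadingCoeff_X_pow, div_one, leadingCoeff, h2] at h1
      exact h1
    · have hlt : f.degree < p := lt_of_le_of_ne (natDegree_le_iff_degree_le.1 hf) hd
      rw [coeff_eq_zero_of_degree_lt hlt]
      exact f.div_tendsto_atTop_zero_of_degree_lt (X ^ p) (by rwa [degree_X_pow])
  have := h.comp tendsto_natCast_atTop_atTop
  simpa [Function.comp_def] using this

lemma intLattice_eq_span (d : ℕ) :
    intLattice d = Submodule.span ℤ (Set.range (Pi.basisFun ℝ (Fin d))) := by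
  ext x
  rw [Module.Basis.mem_span_iff_repr_mem]
  exact Iff.rfl

instance (d : ℕ) : DiscreteTopology (intLattice d) := by
  rw [intLattice_eq_span]
  infer_instance

instance {d : ℕ} (F : Set (Fin d → ℝ)) : DiscreteTopology (directionLattice F) :=
  ZLattice.comap_discreteTopology ℝ (intLattice d) (e := (vectorSpan ℝ F).subtype)
    continuous_subtype_val Subtype.val_injective

/-- Differences of the integral generators are lattice vectors and already span the direction space.
-/
lemma isZLattice_directionLattice {d : ℕ} {S : Finset (Fin d → ℝ)} (hne : S.Nonempty)
    (hS : ∀ s ∈ S, s ∈ intLattice d) :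
    IsZLattice ℝ (directionLattice (convexHull ℝ (S : Set (Fin d → ℝ)))) := by
  obtain ⟨v, hv⟩ := hne
  refine ⟨?_⟩
  let W := vectorSpan ℝ (convexHull ℝ (S : Set (Fin d → ℝ)))
  have hW : W = Submodule.span ℝ ((· -ᵥ v) '' (S : Set (Fin d → ℝ))) := by
    rw [← vectorSpan_eq_span_vsub_set_right ℝ (show v ∈ (S : Set (Fin d → ℝ)) from hv),
      ← direction_affineSpan, ← affineSpan_convexHull, direction_affineSpan]
  have hle : W ≤ (Submodule.span ℝ
      (directionLattice (convexHull ℝ (S : Set (Fin d → ℝ))) : Set W)).map W.subtype := by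
    refine hW.le.trans (Submodule.span_le.2 ?_)
    rintro _ ⟨s, hs, rfl⟩
    refine ⟨⟨s - v, vsub_mem_vectorSpan ℝ (subset_convexHull ℝ _ hs)
      (subset_convexHull ℝ _ hv)⟩, Submodule.subset_span ?_, rfl⟩
    exact sub_mem (hS s hs) (hS v hv)
  rw [eq_top_iff]
  rintro w -
  obtain ⟨w', hw', heq⟩ := hle w.2
  rwa [← Subtype.ext heq]

/-- The volume in lattice coordinates is the volume divided by the covolume. -/
lemma volume_image_eq_addHaar_div_covolume {W ι : Type*} [NormedAddCommGroup W] [NormedSpace ℝ W]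
    [FiniteDimensional ℝ W] [MeasurableSpace W] [BorelSpace W] [Fintype ι] (L : Submodule ℤ W)
    [DiscreteTopology L] [IsZLattice ℝ L] (b : Module.Basis ι ℤ L) (μ : Measure W)
    [μ.IsAddHaarMeasure] (s : Set W) :
    (volume : Measure (ι → ℝ)).real ((b.ofZLatticeBasis ℝ L).equivFun '' s) =
      μ.real s / ZLattice.covolume L μ := by
  let e : W ≃L[ℝ] (ι → ℝ) := (b.ofZLatticeBasis ℝ L).equivFunL
  have he : ∀ w, e w = (b.ofZLatticeBasis ℝ L).equivFun w := fun _ => rfl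
  let em : W ≃ᵐ (ι → ℝ) := e.toHomeomorph.toMeasurableEquiv
  have hν : (μ.map e).IsAddHaarMeasure := e.isAddHaarMeasure_map μ
  let c := Measure.addHaarScalarFactor (μ.map e) volume
  have hc : μ.map e = c • volume := Measure.isAddLeftInvariant_eq_smul _ _
  have hpre : ∀ A : Set (ι → ℝ), μ (e ⁻¹' A) = c * volume A := by
    intro A
    have h1 : μ.map e A = μ (e ⁻¹' A) := em.map_apply A
    rw [← h1, hc]
    rfl
  have hs : μ s = c * volume ((b.ofZLatticeBasis ℝ L).equivFun '' s) := by
    rw [← hpre]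
    congr 1
    ext w
    simp [he]
  -- The fundamental domain is the preimage of the unit cube, so the Haar scaling factor is the
  -- covolume.
  have hcov : ZLattice.covolume L μ = c := by
    rw [ZLattice.covolume_eq_measure_fundamentalDomain L μ (ZLattice.isAddFundamentalDomain b μ)]
    have h2 : ZSpan.fundamentalDomain (b.ofZLatticeBasis ℝ L) =
        e ⁻¹' (Set.univ.pi fun _ => Set.Ico (0 : ℝ) 1) := by
      ext w
      simp [ZSpan.mem_fundamentalDomain, he]
    rw [Measure.real, h2, hpre]
    simp [Real.volume_pi_Ico]
  have hcpos : (0 : ℝ) < c := Measure.addHaarScalarFactor_pos_of_isAddHaarMeasure _ _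
  rw [hcov, eq_div_iff hcpos.ne', Measure.real, Measure.real, hs, ENNReal.toReal_mul,
    ENNReal.coe_toReal, mul_comm]

/-- The leading coefficient of the Ehrhart polynomial is the normalized volume. -/
theorem latticeVolume_eq_coeff {d p : ℕ} {S : Finset (Fin d → ℝ)} (hne : S.Nonempty)
    (hS : ∀ s ∈ S, s ∈ intLattice d) (hp : polyDim (convexHull ℝ (S : Set (Fin d → ℝ))) = p)
    {f : ℝ[X]} (hf : f.natDegree ≤ p) (hft : ∀ t : ℕ, 1 ≤ t → f.eval (t : ℝ) =
      {x | x ∈ intLattice d ∧ x ∈ (t : ℝ) • convexHull ℝ (S : Set (Fin d → ℝ))}.ncard) :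
    latticeVolume (convexHull ℝ (S : Set (Fin d → ℝ))) = (p.factorial : ℝ) * f.coeff p := by
  have := isZLattice_directionLattice hne hS
  set F := convexHull ℝ (S : Set (Fin d → ℝ)) with hF
  obtain ⟨v, hvS⟩ := hne
  have hv : v ∈ F := subset_convexHull ℝ _ hvS
  have hcomp : IsCompact F := S.finite_toSet.isCompact_convexHull (𝕜 := ℝ)
  let L := directionLattice F
  let b := Module.Free.chooseBasis ℤ L
  have hcard : Fintype.card (Module.Free.ChooseBasisIndex ℤ L) = p := by
    rw [← hp, polyDim, Module.finrank_eq_card_basis (b.ofZLatticeBasis ℝ L)]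
  let s : Set (vectorSpan ℝ F) := {w | v + (w : Fin d → ℝ) ∈ F}
  have hcont : Continuous fun w : vectorSpan ℝ F => v + (w : Fin d → ℝ) := by fun_prop
  have hclosed : IsClosed s := hcomp.isClosed.preimage hcont
  have hconv : Convex ℝ s := by
    have h1 : s = (vectorSpan ℝ F).subtype ⁻¹' ((fun x => v + x) ⁻¹' F) := rfl
    rw [h1]
    exact ((convex_convexHull ℝ _).translate_preimage_right v).linear_preimage _
  have hbdd : Bornology.IsBounded s := by
    obtain ⟨R, hR⟩ := hcomp.isBounded.exists_norm_le
    refine isBounded_iff_forall_norm_le.2 ⟨R + ‖v‖, fun w hw => ?_⟩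
    have h1 := hR _ hw
    have h2 : ‖(w : Fin d → ℝ)‖ ≤ ‖v + (w : Fin d → ℝ)‖ + ‖v‖ := by
      have := norm_sub_le (v + (w : Fin d → ℝ)) v
      rwa [add_sub_cancel_left] at this
    exact h2.trans (by linarith)
  have himg : Convex ℝ ((b.ofZLatticeBasis ℝ L).equivFun '' s) :=
    hconv.linear_image (b.ofZLatticeBasis ℝ L).equivFun.toLinearMap
  have hfront := Convex.addHaar_frontier (E := Module.Free.ChooseBasisIndex ℤ L → ℝ) volume himg
  -- Counting points of ever finer lattices in `s` approximates its volume, as a convex set has null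
  -- frontier. The same counts are values of `f`, whose quotient by `n ^ p` tends to the
  -- coefficient.
  have hlim := ZLattice.covolume.tendsto_card_div_pow'' b hbdd hclosed.measurableSet hfront
  rw [volume_image_eq_addHaar_div_covolume L b Measure.addHaar s, hcard] at hlim
  have hcount : ∀ n : ℕ, 1 ≤ n → (Nat.card (s ∩ (n : ℝ)⁻¹ • (L : Set _) : Set _) : ℝ) =
      f.eval (n : ℝ) := by
    intro n hn
    have hn0 : (n : ℝ) ≠ 0 := by positivity
    rw [hft n hn]
    congr 1
    have hmem : ∀ w : vectorSpan ℝ F, w ∈ (n : ℝ)⁻¹ • (L : Set (vectorSpan ℝ F)) ↔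
        (n : ℝ) • (w : Fin d → ℝ) ∈ intLattice d := by
      intro w
      rw [Set.mem_smul_set_iff_inv_smul_mem₀ (inv_ne_zero hn0), inv_inv]
      exact Iff.rfl
    have hnv : (n : ℝ) • v ∈ intLattice d := by
      rw [Nat.cast_smul_eq_nsmul]
      exact nsmul_mem (hS v hvS) n
    refine Nat.card_congr
      { toFun := fun w => ⟨(n : ℝ) • (v + (w.1 : Fin d → ℝ)), ?_,
          Set.smul_mem_smul_set w.2.1⟩
        invFun := fun x => ⟨⟨(n : ℝ)⁻¹ • x.1 - v, vsub_mem_vectorSpan ℝ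
          ((Set.mem_smul_set_iff_inv_smul_mem₀ hn0 _ _).1 x.2.2) hv⟩, ?_, ?_⟩
        left_inv := fun w => ?_
        right_inv := fun x => ?_ }
    · rw [smul_add]
      exact add_mem hnv ((hmem _).1 w.2.2)
    · show v + ((n : ℝ)⁻¹ • x.1 - v) ∈ F
      rw [add_sub_cancel]
      exact (Set.mem_smul_set_iff_inv_smul_mem₀ hn0 _ _).1 x.2.2
    · rw [hmem]
      show (n : ℝ) • ((n : ℝ)⁻¹ • x.1 - v) ∈ intLattice d
      rw [smul_sub, smul_inv_smul₀ hn0]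
      exact sub_mem x.2.1 hnv
    · apply Subtype.ext
      apply Subtype.ext
      show (n : ℝ)⁻¹ • ((n : ℝ) • (v + (w.1 : Fin d → ℝ))) - v = w.1
      rw [inv_smul_smul₀ hn0, add_sub_cancel_left]
    · apply Subtype.ext
      show (n : ℝ) • (v + ((n : ℝ)⁻¹ • x.1 - v)) = x.1
      rw [add_sub_cancel, smul_inv_smul₀ hn0]
  have hlim' := (tendsto_eval_div_pow hf).congr' (f₂ := fun n : ℕ =>
      (Nat.card (s ∩ (n : ℝ)⁻¹ • (L : Set (vectorSpan ℝ F)) : Set _) : ℝ) / (n : ℝ) ^ p) (by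
    filter_upwards [eventually_ge_atTop 1] with n hn
    rw [hcount n hn])
  have hkey := tendsto_nhds_unique hlim hlim'
  have hFne : F.Nonempty := ⟨v, hv⟩
  have htrans : (Measure.addHaar : Measure (vectorSpan ℝ F)).real
      {w | hFne.some + (w : Fin d → ℝ) ∈ F} = (Measure.addHaar : Measure (vectorSpan ℝ F)).real s := by
    let a : vectorSpan ℝ F := ⟨hFne.some - v, vsub_mem_vectorSpan ℝ hFne.some_mem hv⟩
    have h1 : {w : vectorSpan ℝ F | hFne.some + (w : Fin d → ℝ) ∈ F} = (fun w => w + a) ⁻¹' s := by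
      ext w
      have : hFne.some + (w : Fin d → ℝ) = v + ((w : Fin d → ℝ) + (hFne.some - v)) := by abel
      simp [s, a, this]
    rw [h1, Measure.real, measure_preimage_add_right]
    rfl
  rw [latticeVolume, dif_pos hFne, hp, htrans, hkey]

end LatticeVolume

/-! ### The discriminant formula -/

section DiscriminantFormula

open Polynomial Finset

/-- Ehrhart reciprocity for a face, phrased for the polynomial counting interior points. -/
lemma exists_interior_ehrhart {d p : ℕ} {S : Finset (Fin d → ℝ)}
    (hS : ∀ s ∈ S, s ∈ intLattice d) {F : Set (Fin d → ℝ)}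
    (hF : F ∈ faces (convexHull ℝ (S : Set (Fin d → ℝ))) p) :
    ∃ g : ℝ[X], g.natDegree ≤ p ∧ latticeVolume F = (p.factorial : ℝ) * g.coeff p ∧
      ∀ t : ℕ, 1 ≤ t →
        g.eval (t : ℝ) = {x | x ∈ intLattice d ∧ x ∈ intrinsicInterior ℝ ((t : ℝ) • F)}.ncard ∧
        (-1) ^ p * g.eval (-(t : ℝ)) = {x | x ∈ intLattice d ∧ x ∈ (t : ℝ) • F}.ncard := by
  classical
  obtain ⟨hne, hexp, hdim⟩ := hF
  have hFS := hexp.eq_convexHull_filter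
  set T := S.filter (· ∈ F) with hT
  have hTne : T.Nonempty := by
    rw [hFS, convexHull_nonempty_iff] at hne
    exact_mod_cast hne
  have hTS : ∀ s ∈ T, s ∈ intLattice d := fun s hs => hS s (mem_filter.1 hs).1
  rw [hFS] at hdim ⊢
  obtain ⟨f, hf, hft⟩ := exists_ehrhart hTne hTS hdim
  have hvol := latticeVolume_eq_coeff hTne hTS hdim hf fun t ht => (hft t ht).1
  have hsq : (-1 : ℝ) ^ p * (-1) ^ p = 1 := by rw [← mul_pow]; simp
  -- This is `(-1)^p f(-t)`; the two signs cancel in degree `p`.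
  refine ⟨C ((-1) ^ p) * f.comp (C (-1) * X), ?_, ?_, fun t ht => ⟨?_, ?_⟩⟩
  · refine (natDegree_C_mul_le _ _).trans ?_
    rwa [natDegree_comp, natDegree_C_mul_X _ (by norm_num), mul_one]
  · rw [hvol, coeff_C_mul, comp_C_mul_X_coeff, mul_left_comm ((-1 : ℝ) ^ p), hsq, mul_one]
  · rw [← (hft t ht).2]
    simp
  · rw [← (hft t ht).1, eval_mul, eval_C, ← mul_assoc, hsq]
    simp

/-- The relative interiors of the dilated faces partition the lattice points of a dilated face. -/
lemma ncard_eq_sum_ncard_interior {d : ℕ} {S : Finset (Fin d → ℝ)}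
    {𝓕 : Finset (Set (Fin d → ℝ))}
    (h𝓕 : ∀ F, F ∈ 𝓕 ↔ F.Nonempty ∧ IsExposed ℝ (convexHull ℝ (S : Set (Fin d → ℝ))) F)
    {F : Set (Fin d → ℝ)} (hF : F ∈ 𝓕) {t : ℕ} (ht : 1 ≤ t)
    [DecidablePred fun G : Set (Fin d → ℝ) => G ⊆ F] :
    {x | x ∈ intLattice d ∧ x ∈ (t : ℝ) • F}.ncard = ∑ G ∈ 𝓕 with G ⊆ F,
      {x | x ∈ intLattice d ∧ x ∈ intrinsicInterior ℝ ((t : ℝ) • G)}.ncard := by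
  classical
  have ht0 : (0 : ℝ) < t := by exact_mod_cast ht
  have hexp := ((h𝓕 F).1 hF).2
  have hconv : ∀ G ∈ 𝓕, Convex ℝ G := fun G hG =>
    ((h𝓕 G).1 hG).2.convex (convex_convexHull ℝ _)
  have hcomp : IsCompact F := hexp.isCompact (S.finite_toSet.isCompact_convexHull (𝕜 := ℝ))
  have hfin : {x | x ∈ intLattice d ∧ x ∈ (t : ℝ) • F}.Finite := by
    obtain ⟨R, hR⟩ := (hcomp.smul (t : ℝ)).isBounded.exists_norm_le
    exact (finite_intLattice_norm_le d R).subset fun x hx => ⟨hx.1, hR x hx.2⟩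
  have hint : ∀ G ∈ 𝓕, ∀ x, x ∈ intrinsicInterior ℝ ((t : ℝ) • G) ↔
      (t : ℝ)⁻¹ • x ∈ intrinsicInterior ℝ G := by
    intro G hG x
    rw [← smul_mem_intrinsicInterior_smul_iff (hconv G hG) ht0, smul_inv_smul₀ ht0.ne']
  have hex : ∀ x ∈ hfin.toFinset, ∃ G ∈ 𝓕.filter (· ⊆ F),
      (t : ℝ)⁻¹ • x ∈ intrinsicInterior ℝ G := by
    intro x hx
    have hx' := (hfin.mem_toFinset.1 hx).2
    rw [Set.mem_smul_set_iff_inv_smul_mem₀ ht0.ne'] at hx'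
    obtain ⟨G, hGF, hG, hxG⟩ := exists_face_mem_intrinsicInterior hexp hx'
    exact ⟨G, mem_filter.2 ⟨(h𝓕 G).2 ⟨⟨_, intrinsicInterior_subset hxG⟩, hG⟩, hGF⟩, hxG⟩
  choose! φ hφ hφx using hex
  rw [Set.ncard_eq_toFinset_card _ hfin, card_eq_sum_card_fiberwise hφ]
  refine sum_congr (by ext; simp) fun G hG => ?_
  obtain ⟨hG𝓕, hGF⟩ := mem_filter.1 hG
  rw [← Set.ncard_coe_finset]
  congr 1
  ext x
  simp only [coe_filter, Set.Finite.mem_toFinset, Set.mem_ofPred_eq]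
  constructor
  · rintro ⟨hx, rfl⟩
    exact ⟨hx.1, (hint _ hG𝓕 x).2 (hφx x (hfin.mem_toFinset.2 hx))⟩
  · rintro ⟨hxL, hxG⟩
    have hxG' := (hint G hG𝓕 x).1 hxG
    have hx : x ∈ intLattice d ∧ x ∈ (t : ℝ) • F := ⟨hxL, by
      rw [Set.mem_smul_set_iff_inv_smul_mem₀ ht0.ne']
      exact hGF (intrinsicInterior_subset hxG')⟩
    have hx' := hfin.mem_toFinset.2 hx
    exact ⟨hx, face_eq_of_mem_intrinsicInterior ((h𝓕 _).1 (mem_filter.1 (hφ x hx')).1).2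
      ((h𝓕 G).1 hG𝓕).2 (hφx x hx') hxG'⟩

/-- The discriminant number of a simple lattice polytope in terms of interior lattice points, for
any choice of the shift `m`. -/
theorem discriminantNumber_eq_sum {d n m : ℕ} {P : Set (Fin d → ℝ)} (hP : IsLatticePolytope P)
    (hn : polyDim P = n) (hs : IsSimplePolytope P) (hm : m ≤ n + 1) :
    discriminantNumber P = ∑ p ∈ range (n + 1), ∑ i ∈ range (n + 1),
      ((-1) ^ (n + 1 + m + (i + 1)) * ((p + 1).choose (m + (i + 1)) : ℝ) +
        (-1) ^ (m + (i + 1)) * ((p + 1).choose (n + 1 - m + (i + 1)) : ℝ)) *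
        ((i + 1 : ℕ) : ℝ) * (interiorPoints P p (i + 1) : ℝ) := by
  classical
  obtain ⟨S, hSne, hS, rfl⟩ := hP.exists_finset
  set P := convexHull ℝ (S : Set (Fin d → ℝ)) with hPdef
  set 𝓕 := (finite_exposed S).toFinset with h𝓕def
  have h𝓕 : ∀ F, F ∈ 𝓕 ↔ F.Nonempty ∧ IsExposed ℝ P F := fun F => by
    rw [h𝓕def, Set.Finite.mem_toFinset]
    exact Iff.rfl
  have hfaces : ∀ p, faces P p = ((𝓕.filter (polyDim · = p) : Finset _) : Set _) := by
    intro p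
    ext F
    simp only [faces, coe_filter, h𝓕, Set.mem_ofPred_eq, and_assoc]
  have hmem : ∀ F ∈ 𝓕, F ∈ faces P (polyDim F) := fun F hF =>
    ⟨((h𝓕 F).1 hF).1, ((h𝓕 F).1 hF).2, rfl⟩
  have hdim : ∀ F ∈ 𝓕, polyDim F ∈ range (n + 1) := fun F hF => by
    have := Submodule.finrank_mono (vectorSpan_mono ℝ ((h𝓕 F).1 hF).2.subset)
    rw [mem_range, ← hn]
    exact Nat.lt_succ_of_le this
  have hex : ∀ F ∈ 𝓕, _ := fun F hF => exists_interior_ehrhart hS (hmem F hF)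
  choose! g hgdeg hgvol hgt using hex
  let I : Set (Fin d → ℝ) → ℕ → ℕ := fun G t =>
    {x | x ∈ intLattice d ∧ x ∈ intrinsicInterior ℝ ((t : ℝ) • G)}.ncard
  have hIdef : ∀ p t, interiorPoints P p t = ∑ F ∈ 𝓕 with polyDim F = p, I F t := by
    intro p t
    rw [interiorPoints, hfaces, finsum_mem_coe_finset]
  have hcount : ∀ p ≤ n, ∀ G ∈ 𝓕, (#{F ∈ 𝓕 | polyDim F = p ∧ G ⊆ F}) =
      (n - polyDim G).choose (n - p) := by
    intro p hp G hG
    have := hs.ncard_faces (p := p) (by rwa [← hPdef, hn]) (hmem G hG)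
    rw [← hPdef, hn] at this
    rw [← this, ← Set.ncard_coe_finset]
    congr 1
    ext F
    simp only [hfaces, coe_filter, Set.mem_ofPred_eq, and_assoc]
  have hsum := sum_coeff_eq_of_reciprocity hm
    (g := fun p => ∑ F ∈ 𝓕 with polyDim F = p, g F)
    (I := fun p t => (interiorPoints P p t : ℝ)) ?_ ?_ ?_
  · rw [← hsum, discriminantNumber, hn]
    refine sum_congr rfl fun p _ => ?_
    rw [mul_assoc]
    congr 1
    rw [hfaces, finsum_mem_coe_finset, finsetSum_coeff, Nat.factorial_succ]
    push_cast
    rw [mul_assoc]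
    congr 1
    rw [mul_sum]
    refine sum_congr rfl fun F hF => ?_
    obtain ⟨hF𝓕, rfl⟩ := mem_filter.1 hF
    exact hgvol F hF𝓕
  · intro p _
    refine natDegree_sum_le_of_forall_le _ _ fun F hF => ?_
    obtain ⟨hF𝓕, rfl⟩ := mem_filter.1 hF
    exact hgdeg F hF𝓕
  · intro p _ k hk
    rw [hIdef, eval_finsetSum, Nat.cast_sum]
    exact sum_congr rfl fun F hF => (hgt F (mem_filter.1 hF).1 k hk).1
  · intro p hp k hk
    rw [eval_finsetSum, mul_sum]
    have h1 : ∀ F ∈ 𝓕.filter (polyDim · = p), (-1 : ℝ) ^ p * (g F).eval (-(k : ℝ)) =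
        ∑ G ∈ 𝓕 with G ⊆ F, (I G k : ℝ) := by
      intro F hF
      obtain ⟨hF𝓕, rfl⟩ := mem_filter.1 hF
      rw [(hgt F hF𝓕 k hk).2, ncard_eq_sum_ncard_interior h𝓕 hF𝓕 hk, Nat.cast_sum]
    -- Double counting of pairs `G ⊆ F` with `F` of dimension `p`: grouping by `G` brings in the
    -- number of `p`-faces through `G`.
    rw [sum_congr rfl h1, sum_comm' (t' := 𝓕)
      (s' := fun G => 𝓕.filter fun F => polyDim F = p ∧ G ⊆ F)
      (by intro F G; simp only [mem_filter]; tauto)]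
    rw [← sum_fiberwise_of_maps_to hdim]
    refine sum_congr rfl fun q _ => ?_
    rw [hIdef, Nat.cast_sum, mul_sum]
    refine sum_congr rfl fun G hG => ?_
    obtain ⟨hG𝓕, rfl⟩ := mem_filter.1 hG
    rw [sum_const, hcount p hp G hG𝓕, nsmul_eq_mul]

lemma neg_one_zpow_sub (m i : ℕ) : (-1 : ℝ) ^ ((m : ℤ) - (i : ℤ)) = (-1) ^ (m + i) := by
  rw [zpow_sub₀ (by norm_num), zpow_natCast, zpow_natCast, pow_add, div_eq_mul_inv, ← inv_pow]
  norm_num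

/-- The square range is convenient for exchanging sums; only the triangle where the binomials can be
nonzero survives. -/
lemma sum_range_eq_sum_Icc {n m : ℕ} {c : ℕ → ℕ → ℝ}
    (hc : ∀ p i, p + 1 < m + i → c p i = 0) :
    ∑ p ∈ range (n + 1), ∑ i ∈ range (n + 1), c p (i + 1) =
      ∑ p ∈ Icc m n, ∑ i ∈ Icc 1 (p + 1 - m), c p i := by
  have h1 : ∀ p ∈ range (n + 1), ∑ i ∈ range (n + 1), c p (i + 1) =
      ∑ i ∈ Icc 1 (p + 1 - m), c p i := by
    intro p hp
    have hp' := mem_range.1 hp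
    rw [range_eq_Ico, sum_Ico_add' (c p) 0 (n + 1) 1]
    refine (sum_subset (fun i hi => ?_) fun i hi hi' => hc p i ?_).symm
    · rw [mem_Icc] at hi
      rw [mem_Ico]
      omega
    · rw [mem_Ico] at hi
      rw [mem_Icc] at hi'
      omega
  rw [sum_congr rfl h1]
  refine (sum_subset (fun p hp => ?_) fun p hp hp' => ?_).symm
  · rw [mem_Icc] at hp
    rw [mem_range]
    omega
  · rw [mem_Icc] at hp'
    rw [mem_range] at hp
    rw [Icc_eq_empty (by omega), sum_empty]

end DiscriminantFormula

theorem theorem2 {d n : ℕ} (P : Set (Fin d → ℝ)) (hP : IsLatticePolytope P)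
    (hn : polyDim P = n) (hs : IsSimplePolytope P) :
    (∀ m : ℕ, n + 1 = 2 * m →
      discriminantNumber P =
        ∑ p ∈ Finset.Icc m n, ∑ i ∈ Finset.Icc 1 (p + 1 - m),
          (-1 : ℝ) ^ ((m : ℤ) - (i : ℤ)) * ((p + 1).choose (m + i) : ℝ) * 2 * (i : ℝ) *
            (interiorPoints P p i : ℝ)) ∧
    (∀ m : ℕ, n = 2 * m →
      discriminantNumber P =
        ∑ p ∈ Finset.Icc m n, ∑ i ∈ Finset.Icc 1 (p + 1 - m),
          (-1 : ℝ) ^ ((m : ℤ) + 1 - (i : ℤ)) *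
            (((p + 1).choose (m + i) : ℝ) - ((p + 1).choose (m + i + 1) : ℝ)) * (i : ℝ) *
            (interiorPoints P p i : ℝ)) := by
  refine ⟨fun m hm => ?_, fun m hm => ?_⟩
  · rw [discriminantNumber_eq_sum hP hn hs (m := m) (by omega), ← sum_range_eq_sum_Icc]
    · refine Finset.sum_congr rfl fun p _ => Finset.sum_congr rfl fun i _ => ?_
      -- Here `n + 1 - m = m`, so both binomials and both signs coincide, giving the factor `2`.
      rw [neg_one_zpow_sub, show n + 1 - m = m by omega, hm, add_assoc (2 * m), pow_add _ (2 * m),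
        pow_mul, neg_one_sq, one_pow]
      ring
    · intro p i hpi
      rw [Nat.choose_eq_zero_of_lt hpi]
      simp
  · rw [discriminantNumber_eq_sum hP hn hs (m := m) (by omega), ← sum_range_eq_sum_Icc]
    · refine Finset.sum_congr rfl fun p _ => Finset.sum_congr rfl fun i _ => ?_
      have h1 := neg_one_zpow_sub (m + 1) (i + 1)
      push_cast at h1 ⊢
      -- Here `n + 1 - m = m + 1`: the second binomial is shifted by one and has the opposite sign.
      rw [h1, show n + 1 - m + (i + 1) = m + (i + 1) + 1 by omega,
        show n + 1 + m + (i + 1) = 2 * m + (m + 1 + (i + 1)) by omega, pow_add _ (2 * m), pow_mul,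
        neg_one_sq, one_pow]
      ring
    · intro p i hpi
      rw [Nat.choose_eq_zero_of_lt hpi, Nat.choose_eq_zero_of_lt (by omega)]
      simp
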